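/- Let $\Omega=(0,1)$, $V=H^1_0(\Omega)$, $\alpha>0$, $u_d\in L^\infty(\Omega)$, $a\in C^{0,1}([0,1])$ with $a\ge\nu>0$ on $[0,1]$ for a constant $\nu$, and $d_0\in L^\infty(\Omega)$ with $d_0\ge 0$ a.e. Put $$\mathfrak a(v,w)=\int_\Omega a\,v'w'\,dx+\int_\Omega d_0\,v\,w\,dx ,\qquad J(u,q)=\tfrac12\|u-u_d\|_{L^2(\Omega)}^2+\alpha\|q'\|_{\mathcal M(\Omega)} ,$$ where $\|q'\|_{\mathcal M(\Omega)}$ is the total variation of the distributional derivative of $q\in BV(\Omega)$. Let $\bar u$ be the optimal state of the problem (P): minimize $J(u,q)$ over $(u,q)\in V\times BV(\Omega)$ subject to $\mathfrak a(u,w)=\int_\Omega q\,w\,dx$ for all $w\in V$. For a mesh $0=x_0<x_1<\dots<x_l=1$ with $l>1$, let $h=\max_{1\le i\le l}(x_i-x_{i-1})$, let $V_h\subset V$ be the continuous functions on $[0,1]$ that vanish at $0$ and $1$ and are affine on each $(x_{i-1},x_i)$, and let $Q_h\subset BV(\Omega)$ be the functions that are constant on each $(x_{i-1},x_i)$. Consider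 the problem $(\mathrm P_{\mathrm{cd}})$: minimize $J(u_h,q_h)$ over $(u_h,q_h)\in V_h\times Q_h$ subject to $\mathfrak a(u_h,w_h)=\int_\Omega q_h\,w_h\,dx$ for all $w_h\in V_h$. Then there is a constant $C>0$, depending only on $\alpha,\nu,a,d_0,u_d$ and in particular not on the mesh, such that for every such mesh and every optimal pair $(\hat u_h,\hat q_h)$ of $(\mathrm P_{\mathrm{cd}})$ $$\|\hat u_h-\bar u\|_{L^2(\Omega)}\le C\,h .$$ -/

import Mathlib

open MeasureTheory Set
open scoped ENNReal NNReal ContDiff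

noncomputable section

namespace BVControl

/-- Lebesgue measure on the spatial domain `Ω = (0,1)`. Functions on `Ω` are represented by
functions `ℝ → ℝ`, of which only the values in `Ω` (or in its closure) matter. -/
def volΩ : Measure ℝ := volume.restrict (Ioo (0 : ℝ) 1)

/-- `φ ∈ C_c^∞(Ω)`. -/
def IsTestFunction (φ : ℝ → ℝ) : Prop :=
  ContDiff ℝ ∞ φ ∧ HasCompactSupport φ ∧ tsupport φ ⊆ Ioo (0 : ℝ) 1

/-- `g` is a weak derivative of `v` in `Ω`. -/
def IsWeakDeriv (v g : ℝ → ℝ) : Prop :=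
  ∀ φ : ℝ → ℝ, IsTestFunction φ →
    ∫ x, v x * deriv φ x ∂volΩ = - ∫ x, g x * φ x ∂volΩ

/-- `v ∈ H¹(Ω)`. -/
def MemH1 (v : ℝ → ℝ) : Prop :=
  MemLp v 2 volΩ ∧ ∃ g : ℝ → ℝ, MemLp g 2 volΩ ∧ IsWeakDeriv v g

open Classical in
/-- The weak derivative `v' ∈ L²(Ω)` of `v ∈ H¹(Ω)` (unique almost everywhere); the value `0` is
used for functions without a weak derivative in `L²(Ω)`. -/
def weakDeriv (v : ℝ → ℝ) : ℝ → ℝ :=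
  if h : ∃ g : ℝ → ℝ, MemLp g 2 volΩ ∧ IsWeakDeriv v g then h.choose else 0

/-- `v ∈ V = H¹₀(Ω)`, the closure of `C_c^∞(Ω)` in `H¹(Ω)`. -/
def MemH10 (v : ℝ → ℝ) : Prop :=
  MemH1 v ∧ ∀ ε : ℝ, 0 < ε → ∃ φ : ℝ → ℝ, IsTestFunction φ ∧
    eLpNorm (fun x => v x - φ x) 2 volΩ ≤ ENNReal.ofReal ε ∧
    eLpNorm (fun x => weakDeriv v x - deriv φ x) 2 volΩ ≤ ENNReal.ofReal ε

/-- The norm `‖q'‖_{M(Ω)} ∈ [0,∞]` of the distributional derivative of `q ∈ L¹(Ω)`: the supremum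
of `⟨q', φ⟩ = -∫ q φ'` over all test functions with `|φ| ≤ 1`. It is finite exactly if the
distribution `q'` is a finite Radon measure. -/
def derivMeasureNorm (q : ℝ → ℝ) : ℝ≥0∞ :=
  ⨆ (φ : ℝ → ℝ) (_ : IsTestFunction φ ∧ ∀ x, |φ x| ≤ 1),
    ENNReal.ofReal (- ∫ x, q x * deriv φ x ∂volΩ)

/-- `q ∈ Q = BV(Ω)`. -/
def MemBV (q : ℝ → ℝ) : Prop :=
  Integrable q volΩ ∧ derivMeasureNorm q < ⊤

/-- The bilinear form `𝔞(v,w) = (a v', w') + (d₀ v, w)` on `V`. -/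
def energyForm (a d₀ v w : ℝ → ℝ) : ℝ :=
  (∫ x, a x * weakDeriv v x * weakDeriv w x ∂volΩ) + ∫ x, d₀ x * v x * w x ∂volΩ

/-- The objective `J(u,q) = ½ ‖u - u_d‖²_{L²(Ω)} + α ‖q'‖_{M(Ω)}` for `u ∈ V`, `q ∈ BV(Ω)`. -/
def objective (α : ℝ) (u_d u q : ℝ → ℝ) : ℝ :=
  1 / 2 * (∫ x, (u x - u_d x) ^ 2 ∂volΩ) + α * (derivMeasureNorm q).toReal

/-- `(u,q) ∈ V × Q` satisfies the state equation `𝔞(u,w) = (q,w)` for all `w ∈ V`. -/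
def Feasible (a d₀ u q : ℝ → ℝ) : Prop :=
  MemH10 u ∧ MemBV q ∧
    ∀ w : ℝ → ℝ, MemH10 w → energyForm a d₀ u w = ∫ x, q x * w x ∂volΩ

/-- `(u,q)` is an optimal state with associated optimal control of the continuous problem. -/
def IsOptimal (α : ℝ) (a d₀ u_d u q : ℝ → ℝ) : Prop :=
  Feasible a d₀ u q ∧
    ∀ v p : ℝ → ℝ, Feasible a d₀ v p → objective α u_d u q ≤ objective α u_d v p

/-- A mesh `0 = x₀ < x₁ < ⋯ < x_l = 1` with `l > 1`. -/
structure Mesh where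
  l : ℕ
  one_lt : 1 < l
  node : Fin (l + 1) → ℝ
  strictMono : StrictMono node
  node_zero : node 0 = 0
  node_last : node (Fin.last l) = 1

/-- The subinterval of the mesh between the `i`-th node and the next one. -/
def Mesh.cell (T : Mesh) (i : Fin T.l) : Set ℝ :=
  Ioo (T.node i.castSucc) (T.node i.succ)

/-- The mesh width `h`, the maximal length of a subinterval. -/
def Mesh.width (T : Mesh) : ℝ :=
  ⨆ i : Fin T.l, (T.node i.succ - T.node i.castSucc)

/-- `v ∈ V_h`: `v ∈ V` is continuous on `[0,1]`, vanishes at both end points, and is affine on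
each subinterval. -/
def MemVh (T : Mesh) (v : ℝ → ℝ) : Prop :=
  MemH10 v ∧ ContinuousOn v (Icc 0 1) ∧ v 0 = 0 ∧ v 1 = 0 ∧
    ∀ i : Fin T.l, ∃ m b : ℝ, ∀ x ∈ T.cell i, v x = m * x + b

/-- `q ∈ Q_h`: `q ∈ BV(Ω)` is (almost everywhere) constant on each subinterval. -/
def MemQh (T : Mesh) (q : ℝ → ℝ) : Prop :=
  MemBV q ∧ ∀ i : Fin T.l, ∃ c : ℝ, ∀ᵐ x ∂(volume.restrict (T.cell i)), q x = c

/-- `(u,q) ∈ V_h × Q_h` satisfies `𝔞(u,w) = (q,w)` for all `w ∈ V_h`. -/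
def FeasibleCd (T : Mesh) (a d₀ u q : ℝ → ℝ) : Prop :=
  MemVh T u ∧ MemQh T q ∧
    ∀ w : ℝ → ℝ, MemVh T w → energyForm a d₀ u w = ∫ x, q x * w x ∂volΩ

/-- `(u,q)` is an optimal state with associated optimal control of the discretized problem with
piecewise constant controls. -/
def IsOptimalCd (T : Mesh) (α : ℝ) (a d₀ u_d u q : ℝ → ℝ) : Prop :=
  FeasibleCd T a d₀ u q ∧
    ∀ v p : ℝ → ℝ, FeasibleCd T a d₀ v p → objective α u_d u q ≤ objective α u_d v p

end BVControl

end

noncomputable section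

namespace BVControl

open Filter Topology

/-! A function in V is the primitive of its derivative, and these derivatives are exactly the
mean-zero elements of L²(Ω). The state equation thus becomes a symmetric coercive problem for g = u'
on `meanZero`, and its discretization the same problem on the cellwise constant functions in
`Mesh.gradSpace`. Write S and S_h for the two solution operators from controls to states, P for the
cellwise average `Mesh.proj`, TV for the total variation, and (u, q), (u_h, q_h) for the optimal
pairs.

Convexity gives a variational inequality for each minimizer (`IsMin.variational_ineq`). Test the
continuous one with q_h, the discrete one with Pq, and add. The total variations leave α (TV(Pq) −
TV(q)) ≤ 0 (`Mesh.memBV_proj`), so ‖u_h − u‖² ≤ (u − u_d, (S − S_h) q_h) + (u_h − u_d, (S_h − S) Pq)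
+ (u_h − u_d, S(Pq − q)). Each term is O(h²), whence the order h for the norm. The first two are
handled by Aubin–Nitsche duality (`exists_galerkin_error`): bounded data make the derivatives of the
primal and of the dual solution Lipschitz (`exists_regularity`), and each is approximated to order
h. The third equals ∫ q (Pp − p) with the dual state p. The primitive of Pp − p vanishes at the
nodes and is O(h²) uniformly, and pairing with q costs only TV(q) (`exists_proj_error`).

The constants are uniform because the controls are bounded in L^∞. Comparison with the zero control
bounds TV, which bounds a control up to an additive constant. That constant is read off from the
state, since (1, S_h 1) is bounded below on fine meshes (`exists_width_le`). On coarse meshes a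
trivial bound suffices. -/

instance : IsProbabilityMeasure volΩ := ⟨by simp [volΩ]⟩

instance : NullSingletonClass volΩ := by unfold volΩ; infer_instance

/-! ### L²(Ω) and the primitive operator. -/

/-- The space `L²(Ω)`. -/
abbrev L2Ω : Type := Lp ℝ 2 volΩ

/-- The primitive of `g` that vanishes at the left end point of `Ω`. -/
def prim (g : ℝ → ℝ) (x : ℝ) : ℝ := ∫ t in Iic x, g t ∂volΩ

theorem ae_volΩ_mem : ∀ᵐ x ∂volΩ, x ∈ Ioo (0 : ℝ) 1 := ae_restrict_mem measurableSet_Ioo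

theorem integrable_of_memLp_two {f : ℝ → ℝ} (hf : MemLp f 2 volΩ) : Integrable f volΩ :=
  hf.integrable (by norm_num)

theorem integrable_L2Ω (g : L2Ω) : Integrable g volΩ := integrable_of_memLp_two (Lp.memLp g)

theorem inner_L2Ω (f g : L2Ω) : inner ℝ f g = ∫ x, f x * g x ∂volΩ := by
  rw [L2.inner_def]
  exact integral_congr_ae (.of_forall fun x => by simp [mul_comm])

theorem inner_toLp {f g : ℝ → ℝ} (hf : MemLp f 2 volΩ) (hg : MemLp g 2 volΩ) :
    inner ℝ (hf.toLp f) (hg.toLp g) = ∫ x, f x * g x ∂volΩ := by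
  rw [inner_L2Ω]
  apply integral_congr_ae
  filter_upwards [hf.coeFn_toLp, hg.coeFn_toLp] with x h1 h2
  rw [h1, h2]

theorem norm_sq_L2Ω (f : L2Ω) : ‖f‖ ^ 2 = ∫ x, f x ^ 2 ∂volΩ := by
  rw [← real_inner_self_eq_norm_sq, inner_L2Ω]
  simp_rw [sq]

theorem integral_abs_le_norm (g : L2Ω) : ∫ x, |g x| ∂volΩ ≤ ‖g‖ := by
  have h1 : ∫ x, |g x| ∂volΩ = (eLpNorm g 1 volΩ).toReal := by
    rw [eLpNorm_one_eq_lintegral_enorm, ← integral_norm_eq_lintegral_enorm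
      (Lp.aestronglyMeasurable g)]
    rfl
  rw [h1, Lp.norm_def]
  exact ENNReal.toReal_mono (Lp.eLpNorm_ne_top g)
    (eLpNorm_le_eLpNorm_of_exponent_le (by norm_num) (Lp.aestronglyMeasurable g))

theorem prim_congr {f g : ℝ → ℝ} (h : f =ᵐ[volΩ] g) : prim f = prim g := by
  funext x
  exact integral_congr_ae (ae_restrict_of_ae h)

theorem prim_add {f g : ℝ → ℝ} (hf : Integrable f volΩ) (hg : Integrable g volΩ) (x : ℝ) :
    prim (fun t => f t + g t) x = prim f x + prim g x :=
  integral_add hf.integrableOn hg.integrableOn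

theorem prim_sub {f g : ℝ → ℝ} (hf : Integrable f volΩ) (hg : Integrable g volΩ) (x : ℝ) :
    prim (fun t => f t - g t) x = prim f x - prim g x :=
  integral_sub hf.integrableOn hg.integrableOn

theorem prim_const_mul (c : ℝ) (f : ℝ → ℝ) (x : ℝ) :
    prim (fun t => c * f t) x = c * prim f x :=
  integral_const_mul c _

theorem abs_prim_le_integral {g : ℝ → ℝ} (hg : Integrable g volΩ) (x : ℝ) :
    |prim g x| ≤ ∫ t, |g t| ∂volΩ := by
  refine (abs_integral_le_integral_abs).trans ?_
  exact setIntegral_le_integral hg.abs (.of_forall fun t => abs_nonneg _)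

theorem abs_prim_le (g : L2Ω) (x : ℝ) : |prim g x| ≤ ‖g‖ :=
  (abs_prim_le_integral (integrable_L2Ω g) x).trans (integral_abs_le_norm g)

theorem prim_sub_prim {g : ℝ → ℝ} (hg : Integrable g volΩ) (x y : ℝ) :
    prim g y - prim g x = ∫ t in x..y, g t ∂volΩ :=
  intervalIntegral.integral_Iic_sub_Iic hg.integrableOn hg.integrableOn

theorem prim_sub_prim' {g : ℝ → ℝ} (hg : Integrable g volΩ) {x y : ℝ} (hx : 0 ≤ x) (hxy : x ≤ y)
    (hy : y ≤ 1) : prim g y - prim g x = ∫ t in Ioo x y, g t := by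
  rw [prim_sub_prim hg, intervalIntegral.integral_of_le hxy, integral_Ioc_eq_integral_Ioo, volΩ,
    Measure.restrict_restrict measurableSet_Ioo,
    inter_eq_left.2 (Ioo_subset_Ioo hx hy)]

theorem continuous_prim {g : ℝ → ℝ} (hg : Integrable g volΩ) : Continuous (prim g) := by
  have : prim g = fun x => prim g 0 + ∫ t in (0 : ℝ)..x, g t ∂volΩ := by
    funext x
    rw [← prim_sub_prim hg]; ring
  rw [this]
  exact continuous_const.add (intervalIntegral.continuous_primitive
    (fun a b => hg.intervalIntegrable) 0)

theorem prim_of_nonpos (g : ℝ → ℝ) {x : ℝ} (hx : x ≤ 0) : prim g x = 0 := by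
  have : volΩ.restrict (Iic x) = 0 := by
    rw [Measure.restrict_eq_zero, volΩ, Measure.restrict_apply measurableSet_Iic]
    convert measure_empty (μ := (volume : Measure ℝ))
    ext t; simp only [mem_inter_iff, mem_Iic, mem_Ioo, mem_empty_iff_false, iff_false]
    rintro ⟨h1, h2, -⟩; linarith
  simp [prim, this]

theorem prim_of_one_le (g : ℝ → ℝ) {x : ℝ} (hx : 1 ≤ x) : prim g x = ∫ t, g t ∂volΩ := by
  have : volΩ.restrict (Iic x) = volΩ := by
    rw [volΩ, Measure.restrict_restrict measurableSet_Iic]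
    congr 1
    exact inter_eq_right.2 fun t ht => (ht.2.le.trans hx)
  simp [prim, this]

theorem memLp_of_continuous {f : ℝ → ℝ} (hf : Continuous f) (p : ℝ≥0∞) : MemLp f p volΩ := by
  obtain ⟨C, hC⟩ := (isCompact_Icc (a := (0 : ℝ)) (b := 1)).exists_bound_of_continuousOn
    hf.continuousOn
  refine MemLp.of_bound hf.aestronglyMeasurable C ?_
  filter_upwards [ae_volΩ_mem] with x hx using hC x (Ioo_subset_Icc_self hx)

theorem memLp_prim {g : ℝ → ℝ} (hg : Integrable g volΩ) (p : ℝ≥0∞) : MemLp (prim g) p volΩ :=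
  memLp_of_continuous (continuous_prim hg) p

theorem norm_le_of_ae_abs_le {f : L2Ω} {C : ℝ} (hC : 0 ≤ C) (h : ∀ᵐ x ∂volΩ, |f x| ≤ C) :
    ‖f‖ ≤ C := by
  have := Lp.norm_le_of_ae_bound (f := f) hC (by simpa using h)
  simpa [measureUnivNNReal] using this

/-- The primitive as a bounded operator on `L²(Ω)`. -/
def primL : L2Ω →L[ℝ] L2Ω :=
  LinearMap.mkContinuous
    { toFun := fun g => (memLp_prim (integrable_L2Ω g) 2).toLp _
      map_add' := fun f g => by
        rw [← MemLp.toLp_add]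
        apply MemLp.toLp_congr
        refine .of_forall fun x => ?_
        rw [prim_congr (Lp.coeFn_add f g)]
        exact prim_add (integrable_L2Ω f) (integrable_L2Ω g) x
      map_smul' := fun c f => by
        rw [RingHom.id_apply, ← MemLp.toLp_const_smul]
        apply MemLp.toLp_congr
        refine .of_forall fun x => ?_
        rw [prim_congr (Lp.coeFn_smul c f)]
        exact prim_const_mul c _ x } 1 fun g => by
    rw [one_mul]
    refine norm_le_of_ae_abs_le (norm_nonneg _) ?_
    filter_upwards [(memLp_prim (integrable_L2Ω g) 2).coeFn_toLp] with x hx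
    exact (congrArg abs hx).le.trans (abs_prim_le g x)

theorem coeFn_primL (g : L2Ω) : primL g =ᵐ[volΩ] prim g :=
  (memLp_prim (integrable_L2Ω g) 2).coeFn_toLp

theorem norm_primL_le (g : L2Ω) : ‖primL g‖ ≤ ‖g‖ := by
  refine norm_le_of_ae_abs_le (norm_nonneg _) ?_
  filter_upwards [coeFn_primL g] with x hx
  exact (congrArg abs hx).le.trans (abs_prim_le g x)

/-- The constant function `1` in `L²(Ω)`. -/
def oneL : L2Ω := (memLp_const (1 : ℝ)).toLp _

theorem coeFn_oneL : oneL =ᵐ[volΩ] fun _ => (1 : ℝ) := MemLp.coeFn_toLp _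

theorem inner_oneL (g : L2Ω) : inner ℝ oneL g = ∫ x, g x ∂volΩ := by
  rw [inner_L2Ω]
  apply integral_congr_ae
  filter_upwards [coeFn_oneL] with x hx
  rw [hx, one_mul]

/-- The subspace of functions with mean value zero, the derivatives of the elements of `V`. -/
def meanZero : Submodule ℝ L2Ω := (Submodule.span ℝ {oneL})ᗮ

theorem mem_meanZero {g : L2Ω} : g ∈ meanZero ↔ ∫ x, g x ∂volΩ = 0 := by
  rw [meanZero, Submodule.mem_orthogonal_singleton_iff_inner_right, inner_oneL]

instance : CompleteSpace meanZero := by unfold meanZero; infer_instance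

/-! ### Test functions -/

theorem IsTestFunction.memLp {φ : ℝ → ℝ} (h : IsTestFunction φ) (p : ℝ≥0∞) : MemLp φ p volΩ :=
  memLp_of_continuous h.1.continuous p

theorem IsTestFunction.continuous_deriv {φ : ℝ → ℝ} (h : IsTestFunction φ) :
    Continuous (deriv φ) := h.1.continuous_deriv (by simp)

theorem IsTestFunction.memLp_deriv {φ : ℝ → ℝ} (h : IsTestFunction φ) (p : ℝ≥0∞) :
    MemLp (deriv φ) p volΩ :=
  memLp_of_continuous h.continuous_deriv p

theorem IsTestFunction.deriv {φ : ℝ → ℝ} (h : IsTestFunction φ) : IsTestFunction (deriv φ) := by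
  refine ⟨?_, h.2.1.deriv, (tsupport_deriv_subset (𝕜 := ℝ)).trans h.2.2⟩
  have := h.1
  rw [show ((⊤ : ℕ∞) : WithTop ℕ∞) = ((⊤ : ℕ∞) : WithTop ℕ∞) + 1 by rfl, contDiff_succ_iff_deriv] at this
  exact this.2.2

theorem integral_volΩ_of_support {f : ℝ → ℝ} (hf : Function.support f ⊆ Ioo 0 1) :
    ∫ x, f x ∂volΩ = ∫ x, f x :=
  setIntegral_eq_integral_of_forall_compl_eq_zero fun x hx => by
    by_contra h
    exact hx (hf h)

theorem IsTestFunction.prim_deriv {φ : ℝ → ℝ} (h : IsTestFunction φ) (x : ℝ) :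
    prim (_root_.deriv φ) x = φ x := by
  rw [← h.2.1.integral_Iic_deriv_eq (h.1.of_le (by simp)) x, prim, volΩ,
    Measure.restrict_restrict measurableSet_Iic, inter_comm,
    ← Measure.restrict_restrict measurableSet_Ioo]
  exact setIntegral_eq_integral_of_forall_compl_eq_zero fun y hy => by
    by_contra h'
    exact hy (h.deriv.2.2 (subset_tsupport _ h'))

theorem IsTestFunction.integral_deriv {φ : ℝ → ℝ} (h : IsTestFunction φ) :
    ∫ x, _root_.deriv φ x ∂volΩ = 0 := by
  rw [← prim_of_one_le _ (le_refl 1), h.prim_deriv]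
  by_contra h'
  exact absurd (h.2.2 (subset_tsupport _ h')).2 (lt_irrefl _)

theorem IsTestFunction.const_mul {φ : ℝ → ℝ} (h : IsTestFunction φ) (c : ℝ) :
    IsTestFunction fun x => c * φ x :=
  ⟨contDiff_const.mul h.1, h.2.1.mul_left, (tsupport_mul_subset_right).trans h.2.2⟩

theorem IsTestFunction.add {φ ψ : ℝ → ℝ} (h : IsTestFunction φ) (h' : IsTestFunction ψ) :
    IsTestFunction fun x => φ x + ψ x :=
  ⟨h.1.add h'.1, h.2.1.add h'.2.1,
    (tsupport_add φ ψ).trans (union_subset h.2.2 h'.2.2)⟩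

theorem IsTestFunction.zero : IsTestFunction fun _ => (0 : ℝ) :=
  ⟨contDiff_const, HasCompactSupport.zero, by simp [tsupport, Function.support]⟩

theorem IsTestFunction.contDiff_mul {φ ψ : ℝ → ℝ} (h' : IsTestFunction ψ) (h : ContDiff ℝ ∞ φ) :
    IsTestFunction fun x => φ x * ψ x :=
  ⟨h.mul h'.1, h'.2.1.mul_left, (tsupport_mul_subset_right).trans h'.2.2⟩

theorem IsTestFunction.integral_mul_deriv {φ ψ : ℝ → ℝ} (h' : IsTestFunction ψ)
    (h : ContDiff ℝ ∞ φ) :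
    ∫ x, φ x * _root_.deriv ψ x ∂volΩ = - ∫ x, _root_.deriv φ x * ψ x ∂volΩ := by
  have h1 := (h'.contDiff_mul h).integral_deriv
  have h2 : _root_.deriv (fun x => φ x * ψ x) =
      fun x => _root_.deriv φ x * ψ x + φ x * _root_.deriv ψ x := by
    funext x
    exact deriv_fun_mul (h.differentiable (by simp) x) (h'.1.differentiable (by simp) x)
  have h3 : Continuous (_root_.deriv φ) := h.continuous_deriv (by simp)
  rw [h2, integral_add] at h1
  · linarith
  · exact integrable_of_memLp_two (memLp_of_continuous (h3.mul h'.1.continuous) 2)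
  · exact integrable_of_memLp_two (memLp_of_continuous (h.continuous.mul h'.continuous_deriv) 2)

/-! ### Density of test functions and of their derivatives. -/

theorem locallyIntegrableOn_of_integrable {f : ℝ → ℝ} (hf : Integrable f volΩ) {U : Set ℝ}
    (hU : U ⊆ Ioo 0 1) : LocallyIntegrableOn f U volume := by
  have : IntegrableOn f (Ioo 0 1) volume := hf
  exact (this.mono_set hU).locallyIntegrableOn

/-- The fundamental lemma of the calculus of variations on Ω. -/
theorem ae_eq_zero_of_forall_test {f : ℝ → ℝ} (hf : Integrable f volΩ)
    (h : ∀ φ, IsTestFunction φ → ∫ x, f x * φ x ∂volΩ = 0) : f =ᵐ[volΩ] 0 := by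
  have := isOpen_Ioo.ae_eq_zero_of_integral_contDiff_smul_eq_zero
    (locallyIntegrableOn_of_integrable hf subset_rfl) fun g h1 h2 h3 => by
      rw [← h g ⟨h1, h2, h3⟩, integral_volΩ_of_support]
      · simp [mul_comm]
      · exact fun x hx => h3 (subset_tsupport _ (right_ne_zero_of_mul hx))
  exact (ae_restrict_iff' measurableSet_Ioo).2 this

/-- The subspace of test functions in `L²(Ω)`. -/
def testSubmodule : Submodule ℝ L2Ω where
  carrier := {g | ∃ φ, IsTestFunction φ ∧ g =ᵐ[volΩ] φ}
  zero_mem' := ⟨_, .zero, Lp.coeFn_zero _ _ _⟩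
  add_mem' := by
    rintro f g ⟨φ, hφ, h1⟩ ⟨ψ, hψ, h2⟩
    exact ⟨_, hφ.add hψ, (Lp.coeFn_add f g).trans (h1.add h2)⟩
  smul_mem' := by
    rintro c f ⟨φ, hφ, h1⟩
    exact ⟨_, hφ.const_mul c, (Lp.coeFn_smul c f).trans (h1.const_smul c)⟩

theorem testSubmodule_topologicalClosure : testSubmodule.topologicalClosure = ⊤ := by
  rw [Submodule.topologicalClosure_eq_top_iff, Submodule.eq_bot_iff]
  intro f hf
  rw [Lp.eq_zero_iff_ae_eq_zero]
  refine ae_eq_zero_of_forall_test (integrable_L2Ω f) fun φ hφ => ?_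
  have := (Submodule.mem_orthogonal' _ _).1 hf ((hφ.memLp 2).toLp φ)
    ⟨φ, hφ, (hφ.memLp 2).coeFn_toLp⟩
  rw [inner_L2Ω] at this
  rw [← this]
  apply integral_congr_ae
  filter_upwards [(hφ.memLp 2).coeFn_toLp] with x hx
  rw [hx]

theorem exists_test_norm_sub_lt (g : L2Ω) {ε : ℝ} (hε : 0 < ε) :
    ∃ (φ : ℝ → ℝ) (h : IsTestFunction φ), ‖g - (h.memLp 2).toLp φ‖ < ε := by
  have : g ∈ closure (testSubmodule : Set L2Ω) := by
    rw [← Submodule.topologicalClosure_coe, testSubmodule_topologicalClosure]; trivial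
  obtain ⟨f, ⟨φ, hφ, h1⟩, h2⟩ := Metric.mem_closure_iff.1 this ε hε
  refine ⟨φ, hφ, ?_⟩
  rwa [show (hφ.memLp 2).toLp φ = f from
    Lp.ext ((hφ.memLp 2).coeFn_toLp.trans h1.symm), ← dist_eq_norm]

theorem IsTestFunction.tsupport_subset_Icc {φ : ℝ → ℝ} (h : IsTestFunction φ) :
    ∃ a b : ℝ, 0 < a ∧ b < 1 ∧ tsupport φ ⊆ Icc a b := by
  rcases (tsupport φ).eq_empty_or_nonempty with h0 | h0
  · exact ⟨1 / 2, 1 / 2, by norm_num, by norm_num, by simp [h0]⟩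
  · obtain ⟨a, ha⟩ := h.2.1.exists_isLeast h0
    obtain ⟨b, hb⟩ := h.2.1.exists_isGreatest h0
    exact ⟨a, b, (h.2.2 ha.1).1, (h.2.2 hb.1).2, fun x hx => ⟨ha.2 hx, hb.2 hx⟩⟩

theorem IsTestFunction.hasDerivAt_prim {φ : ℝ → ℝ} (h : IsTestFunction φ) (x : ℝ) :
    HasDerivAt (prim φ) (φ x) x := by
  have hint : Integrable φ volume := h.1.continuous.integrable_of_hasCompactSupport h.2.1
  have h1 : ∀ y, prim φ y = (∫ t in Iic (0 : ℝ), φ t) + ∫ t in (0 : ℝ)..y, φ t := by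
    intro y
    rw [← intervalIntegral.integral_Iic_sub_Iic hint.integrableOn hint.integrableOn, prim, volΩ,
      Measure.restrict_restrict measurableSet_Iic, inter_comm,
      ← Measure.restrict_restrict measurableSet_Ioo, setIntegral_eq_integral_of_forall_compl_eq_zero]
    · ring
    · intro t ht
      by_contra h'
      exact ht (h.2.2 (subset_tsupport _ h'))
  rw [funext h1]
  exact (intervalIntegral.integral_hasDerivAt_right (hint.intervalIntegrable)
    h.1.continuous.aestronglyMeasurable.stronglyMeasurableAtFilter
    h.1.continuous.continuousAt).const_add _

theorem IsTestFunction.deriv_prim {φ : ℝ → ℝ} (h : IsTestFunction φ) :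
    _root_.deriv (prim φ) = φ := funext fun x => (h.hasDerivAt_prim x).deriv

theorem IsTestFunction.contDiff_prim {φ : ℝ → ℝ} (h : IsTestFunction φ) :
    ContDiff ℝ ∞ (prim φ) := by
  rw [show ((⊤ : ℕ∞) : WithTop ℕ∞) = ((⊤ : ℕ∞) : WithTop ℕ∞) + 1 by rfl, contDiff_succ_iff_deriv]
  refine ⟨fun x => (h.hasDerivAt_prim x).differentiableAt, by simp, ?_⟩
  rw [h.deriv_prim]
  exact h.1

/-- Left of the support of φ the primitive is 0; right of it, it equals the total integral, which
vanishes by hypothesis. So its support is again compact in Ω. -/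
theorem IsTestFunction.prim {φ : ℝ → ℝ} (h : IsTestFunction φ) (h0 : ∫ x, φ x ∂volΩ = 0) :
    IsTestFunction (BVControl.prim φ) := by
  obtain ⟨a, b, ha, hb, hab⟩ := h.tsupport_subset_Icc
  have hz : ∀ t, t ∉ Icc a b → φ t = 0 := fun t ht => by
    by_contra h'
    exact ht (hab (subset_tsupport _ h'))
  have hsub : tsupport (BVControl.prim φ) ⊆ Icc a b := by
    refine closure_minimal (fun x hx => ?_) isClosed_Icc
    by_contra hxab
    apply hx
    rcases lt_or_ge x a with hxa | hxa
    · exact setIntegral_eq_zero_of_forall_eq_zero fun t ht =>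
        hz t fun h' => absurd (h'.1.trans ht) (not_le.2 hxa)
    · have hxb : b < x := by
        by_contra h'
        exact hxab ⟨hxa, not_lt.1 h'⟩
      rw [← h0]
      exact setIntegral_eq_integral_of_forall_compl_eq_zero fun t ht =>
        hz t fun h' => ht (h'.2.trans hxb.le)
  exact ⟨h.contDiff_prim, HasCompactSupport.of_support_subset_isCompact isCompact_Icc
    ((subset_tsupport _).trans hsub), hsub.trans fun x hx => ⟨ha.trans_le hx.1, hx.2.trans_lt hb⟩⟩

theorem exists_test_integral_eq_one :
    ∃ ψ, IsTestFunction ψ ∧ (∀ x, 0 ≤ ψ x) ∧ ∫ x, ψ x ∂volΩ = 1 := by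
  let f : ContDiffBump (1 / 2 : ℝ) := ⟨1 / 8, 1 / 4, by norm_num, by norm_num⟩
  have h1 : tsupport (f.normed volume) ⊆ Ioo 0 1 := by
    rw [f.tsupport_normed_eq, Real.closedBall_eq_Icc]
    intro x hx
    simp only [f, mem_Icc] at hx
    constructor <;> linarith [hx.1, hx.2]
  refine ⟨f.normed volume, ⟨f.contDiff_normed, f.hasCompactSupport_normed, h1⟩,
    f.nonneg_normed, ?_⟩
  rw [integral_volΩ_of_support ((subset_tsupport _).trans h1), f.integral_normed]

theorem toLp_prim_eq {g : L2Ω} {v : ℝ → ℝ} (hv : MemLp v 2 volΩ) (h : v =ᵐ[volΩ] prim g) :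
    hv.toLp v = primL g :=
  Lp.ext (hv.coeFn_toLp.trans (h.trans (coeFn_primL g).symm))

theorem IsTestFunction.toLp_eq_primL {φ : ℝ → ℝ} (h : IsTestFunction φ) :
    (h.memLp 2).toLp φ = primL ((h.memLp_deriv 2).toLp _) := by
  refine toLp_prim_eq _ (.of_forall fun x => ?_)
  rw [prim_congr (h.memLp_deriv 2).coeFn_toLp, h.prim_deriv]

theorem abs_integral_le_norm (g : L2Ω) : |∫ x, g x ∂volΩ| ≤ ‖g‖ :=
  (abs_integral_le_integral_abs).trans (integral_abs_le_norm g)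

theorem norm_oneL_le : ‖oneL‖ ≤ 1 := by
  refine norm_le_of_ae_abs_le zero_le_one ?_
  filter_upwards [coeFn_oneL] with x hx
  simp [hx]

/-- Approximate g by a test function χ and subtract a multiple of a fixed bump to restore mean value
zero; the primitive is then a test function. Since g has mean zero, the mean of χ is at most ‖g −
χ‖, so the correction is small. -/
theorem exists_test_norm_sub_deriv_lt {g : L2Ω} (hg : g ∈ meanZero) {ε : ℝ} (hε : 0 < ε) :
    ∃ (φ : ℝ → ℝ) (h : IsTestFunction φ), ‖g - (h.memLp_deriv 2).toLp _‖ < ε := by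
  obtain ⟨ψ, hψ, -, hψ1⟩ := exists_test_integral_eq_one
  set Ψ := (hψ.memLp 2).toLp ψ with hΨ
  have hΨ0 : 0 ≤ ‖Ψ‖ := norm_nonneg _
  obtain ⟨χ, hχ, h1⟩ := exists_test_norm_sub_lt g (ε := ε / (1 + ‖Ψ‖)) (by positivity)
  set X := (hχ.memLp 2).toLp χ with hX
  set m := ∫ x, χ x ∂volΩ with hm
  have hmX : m = inner ℝ oneL X := by
    rw [inner_oneL]; exact integral_congr_ae (hχ.memLp 2).coeFn_toLp.symm
  have hm1 : |m| ≤ ‖g - X‖ := by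
    have : m = - inner ℝ oneL (g - X) := by
      rw [inner_sub_right, inner_oneL g, mem_meanZero.1 hg, hmX]; ring
    rw [this, abs_neg, inner_oneL]
    exact abs_integral_le_norm _
  have ht : IsTestFunction fun x => χ x + -m * ψ x := hχ.add (hψ.const_mul _)
  have ht0 : ∫ x, χ x + -m * ψ x ∂volΩ = 0 := by
    rw [integral_add (integrable_of_memLp_two (hχ.memLp 2))
      ((integrable_of_memLp_two (hψ.memLp 2)).const_mul _), integral_const_mul, hψ1]
    ring
  refine ⟨_, ht.prim ht0, ?_⟩
  have heq : ((ht.prim ht0).memLp_deriv 2).toLp _ = X + (-m) • Ψ := by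
    rw [hX, hΨ, ← MemLp.toLp_const_smul, ← MemLp.toLp_add]
    apply MemLp.toLp_congr
    rw [ht.deriv_prim]
    exact .of_forall fun x => rfl
  rw [heq]
  calc ‖g - (X + (-m) • Ψ)‖ = ‖(g - X) + m • Ψ‖ := by congr 1; rw [neg_smul]; abel
    _ ≤ ‖g - X‖ + |m| * ‖Ψ‖ := by
        refine (norm_add_le _ _).trans ?_
        rw [norm_smul, Real.norm_eq_abs]
    _ ≤ ‖g - X‖ * (1 + ‖Ψ‖) := by nlinarith
    _ < ε / (1 + ‖Ψ‖) * (1 + ‖Ψ‖) := by gcongr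
    _ = ε := by field_simp

theorem inner_toLp_right (g : L2Ω) {f : ℝ → ℝ} (hf : MemLp f 2 volΩ) :
    inner ℝ g (hf.toLp f) = ∫ x, g x * f x ∂volΩ := by
  rw [inner_L2Ω]
  apply integral_congr_ae
  filter_upwards [hf.coeFn_toLp] with x h2
  rw [h2]

theorem inner_toLp_left (g : L2Ω) {f : ℝ → ℝ} (hf : MemLp f 2 volΩ) :
    inner ℝ (hf.toLp f) g = ∫ x, f x * g x ∂volΩ := by
  rw [inner_L2Ω]
  apply integral_congr_ae
  filter_upwards [hf.coeFn_toLp] with x h2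
  rw [h2]

theorem inner_primL_right (g f : L2Ω) :
    inner ℝ g (primL f) = ∫ x, g x * prim f x ∂volΩ := by
  rw [inner_L2Ω]
  apply integral_congr_ae
  filter_upwards [coeFn_primL f] with x h2
  rw [h2]

/-- For g a test function this is classical integration by parts. Both sides are continuous in g for
the L² norm, so density gives the rest. -/
theorem integral_prim_mul_deriv (g : L2Ω) {φ : ℝ → ℝ} (hφ : IsTestFunction φ) :
    ∫ x, prim g x * deriv φ x ∂volΩ = - ∫ x, g x * φ x ∂volΩ := by
  have e1 : ∀ g : L2Ω, inner ℝ (primL g) ((hφ.memLp_deriv 2).toLp _) =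
      ∫ x, prim g x * deriv φ x ∂volΩ := by
    intro g
    rw [inner_toLp_right]
    apply integral_congr_ae
    filter_upwards [coeFn_primL g] with x h1
    rw [h1]
  have key : inner ℝ (primL g) ((hφ.memLp_deriv 2).toLp _) =
      - inner ℝ g ((hφ.memLp 2).toLp φ) := by
    have hcl : IsClosed {g : L2Ω | inner ℝ (primL g) ((hφ.memLp_deriv 2).toLp _) =
        - inner ℝ g ((hφ.memLp 2).toLp φ)} :=
      isClosed_eq (by fun_prop) (by fun_prop)
    have hg : g ∈ closure (testSubmodule : Set L2Ω) := by
      rw [← Submodule.topologicalClosure_coe, testSubmodule_topologicalClosure]; trivial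
    refine closure_minimal (fun f hf => ?_) hcl hg
    obtain ⟨χ, hχ, hfχ⟩ := hf
    have h1 := hφ.integral_mul_deriv hχ.contDiff_prim
    rw [hχ.deriv_prim] at h1
    change inner ℝ (primL f) _ = - inner ℝ f _
    rw [e1, inner_toLp_right, prim_congr hfχ, h1]
    congr 1
    apply integral_congr_ae
    filter_upwards [hfχ] with x h2
    rw [h2]
  rwa [e1, inner_toLp_right] at key

/-! ### Identification of V with the primitives of mean-zero functions. -/

theorem eq_of_forall_norm_sub_le {E : Type*} [NormedAddCommGroup E] {x y : E} (C : ℝ)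
    (h : ∀ ε : ℝ, 0 < ε → ‖x - y‖ ≤ C * ε) : x = y := by
  rw [← sub_eq_zero, ← norm_le_zero_iff]
  refine le_of_forall_pos_le_add fun ε hε => ?_
  refine (h (ε / (|C| + 1)) (by positivity)).trans ?_
  rw [zero_add, mul_div_assoc', div_le_iff₀ (by positivity)]
  nlinarith [le_abs_self C]

theorem norm_toLp_le_of_eLpNorm_le {f : ℝ → ℝ} (hf : MemLp f 2 volΩ) {ε : ℝ} (hε : 0 ≤ ε)
    (h : eLpNorm f 2 volΩ ≤ ENNReal.ofReal ε) : ‖hf.toLp f‖ ≤ ε := by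
  rw [Lp.norm_toLp]
  exact ENNReal.toReal_le_of_le_ofReal hε h

theorem MemH1.weakDeriv_spec {v : ℝ → ℝ} (h : MemH1 v) :
    MemLp (weakDeriv v) 2 volΩ ∧ IsWeakDeriv v (weakDeriv v) := by
  rw [weakDeriv, dif_pos h.2]
  exact h.2.choose_spec

theorem MemH10.memLp_weakDeriv {v : ℝ → ℝ} (h : MemH10 v) : MemLp (weakDeriv v) 2 volΩ :=
  h.1.weakDeriv_spec.1

/-- The weak derivative of an element of `V` as an element of `L²(Ω)`. -/
def MemH10.grad {v : ℝ → ℝ} (h : MemH10 v) : L2Ω := h.memLp_weakDeriv.toLp _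

theorem MemH10.coeFn_grad {v : ℝ → ℝ} (h : MemH10 v) : h.grad =ᵐ[volΩ] weakDeriv v :=
  MemLp.coeFn_toLp _

/-- The identity φ = prim φ' holds for test functions and survives the H¹ limit, because `primL` is
a contraction. -/
theorem MemH10.toLp_eq_primL_grad {v : ℝ → ℝ} (h : MemH10 v) :
    h.1.1.toLp v = primL h.grad := by
  refine eq_of_forall_norm_sub_le 2 fun ε hε => ?_
  obtain ⟨φ, hφ, h1, h2⟩ := h.2 ε hε
  have h1' : ‖h.1.1.toLp v - (hφ.memLp 2).toLp φ‖ ≤ ε := by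
    rw [← MemLp.toLp_sub]
    exact norm_toLp_le_of_eLpNorm_le _ hε.le h1
  have h2' : ‖h.grad - (hφ.memLp_deriv 2).toLp _‖ ≤ ε := by
    rw [MemH10.grad, ← MemLp.toLp_sub]
    exact norm_toLp_le_of_eLpNorm_le _ hε.le h2
  calc ‖h.1.1.toLp v - primL h.grad‖
      = ‖(h.1.1.toLp v - (hφ.memLp 2).toLp φ) -
          primL (h.grad - (hφ.memLp_deriv 2).toLp _)‖ := by
        rw [hφ.toLp_eq_primL, map_sub]; congr 1; abel
    _ ≤ ε + ε := (norm_sub_le _ _).trans (add_le_add h1' ((norm_primL_le _).trans h2'))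
    _ = 2 * ε := by ring

theorem MemH10.ae_eq_prim {v : ℝ → ℝ} (h : MemH10 v) : v =ᵐ[volΩ] BVControl.prim h.grad := by
  refine (h.1.1.coeFn_toLp).symm.trans ?_
  rw [h.toLp_eq_primL_grad]
  exact coeFn_primL _

theorem MemH10.grad_mem {v : ℝ → ℝ} (h : MemH10 v) : h.grad ∈ meanZero := by
  rw [mem_meanZero]
  refine eq_of_forall_norm_sub_le 1 fun ε hε => ?_
  obtain ⟨φ, hφ, h1, h2⟩ := h.2 ε hε
  have h2' : ‖h.grad - (hφ.memLp_deriv 2).toLp _‖ ≤ ε := by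
    rw [MemH10.grad, ← MemLp.toLp_sub]
    exact norm_toLp_le_of_eLpNorm_le _ hε.le h2
  have h3 : inner ℝ oneL ((hφ.memLp_deriv 2).toLp _) = 0 := by
    rw [inner_oneL, integral_congr_ae (hφ.memLp_deriv 2).coeFn_toLp, hφ.integral_deriv]
  rw [sub_zero, ← inner_oneL, ← sub_zero (inner ℝ oneL h.grad), ← h3, ← inner_sub_right,
    inner_oneL, one_mul]
  exact (abs_integral_le_norm _).trans h2'

theorem isWeakDeriv_of_ae_eq_prim {g : L2Ω} {v : ℝ → ℝ} (hv : v =ᵐ[volΩ] prim g) :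
    IsWeakDeriv v g := fun φ hφ => by
  rw [← integral_prim_mul_deriv g hφ]
  apply integral_congr_ae
  filter_upwards [hv] with x hx
  rw [hx]

theorem IsWeakDeriv.ae_eq {v f g : ℝ → ℝ} (hf : MemLp f 2 volΩ) (hg : MemLp g 2 volΩ)
    (h1 : IsWeakDeriv v f) (h2 : IsWeakDeriv v g) : f =ᵐ[volΩ] g := by
  have := ae_eq_zero_of_forall_test (f := fun x => f x - g x)
    (integrable_of_memLp_two (hf.sub hg)) fun φ hφ => by
      simp_rw [sub_mul]
      rw [integral_sub]
      · linarith [h1 φ hφ, h2 φ hφ]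
      · exact hf.integrable_mul (hφ.memLp 2)
      · exact hg.integrable_mul (hφ.memLp 2)
  filter_upwards [this] with x hx
  exact sub_eq_zero.1 hx

/-- The converse of `MemH10.ae_eq_prim` and `MemH10.grad_mem`. A test function whose derivative is
close to g is automatically close to v, as `primL` is a contraction. -/
theorem memH10_of_ae_eq_prim {g : L2Ω} (hg : g ∈ meanZero) {v : ℝ → ℝ}
    (hv : v =ᵐ[volΩ] prim g) : MemH10 v ∧ weakDeriv v =ᵐ[volΩ] g := by
  have hvL : MemLp v 2 volΩ := (memLp_congr_ae hv).2 (memLp_prim (integrable_L2Ω g) 2)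
  have h1 : MemH1 v := ⟨hvL, g, Lp.memLp g, isWeakDeriv_of_ae_eq_prim hv⟩
  have h2 : weakDeriv v =ᵐ[volΩ] g :=
    IsWeakDeriv.ae_eq h1.weakDeriv_spec.1 (Lp.memLp g) h1.weakDeriv_spec.2
      (isWeakDeriv_of_ae_eq_prim hv)
  refine ⟨⟨h1, fun ε hε => ?_⟩, h2⟩
  obtain ⟨φ, hφ, hφε⟩ := exists_test_norm_sub_deriv_lt hg hε
  refine ⟨φ, hφ, ?_, ?_⟩
  · have : ‖(hvL.sub (hφ.memLp 2)).toLp (v - φ)‖ ≤ ε := by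
      rw [MemLp.toLp_sub hvL (hφ.memLp 2), toLp_prim_eq hvL hv, hφ.toLp_eq_primL, ← map_sub]
      exact (norm_primL_le _).trans hφε.le
    rw [Lp.norm_toLp] at this
    exact (ENNReal.le_ofReal_iff_toReal_le (hvL.sub (hφ.memLp 2)).eLpNorm_ne_top hε.le).2 this
  · have hm := (Lp.memLp g).sub (hφ.memLp_deriv 2)
    have : ‖hm.toLp _‖ ≤ ε := by
      rw [MemLp.toLp_sub (Lp.memLp g) (hφ.memLp_deriv 2), Lp.toLp_coeFn]
      exact hφε.le
    rw [Lp.norm_toLp] at this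
    have h3 := (ENNReal.le_ofReal_iff_toReal_le hm.eLpNorm_ne_top hε.le).2 this
    refine (eLpNorm_congr_ae ?_).trans_le h3
    filter_upwards [h2] with x hx
    simp [hx]

theorem MemH10.grad_eq {v : ℝ → ℝ} (h : MemH10 v) {g : L2Ω} (hg : g ∈ meanZero)
    (hv : v =ᵐ[volΩ] BVControl.prim g) : h.grad = g :=
  Lp.ext (h.coeFn_grad.trans (memH10_of_ae_eq_prim hg hv).2)

/-! ### Total variation and functions of bounded variation. -/

/-- The total variation of `q` on `Ω` as a real number. -/
def totalVar (q : ℝ → ℝ) : ℝ := (derivMeasureNorm q).toReal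

theorem totalVar_nonneg (q : ℝ → ℝ) : 0 ≤ totalVar q := ENNReal.toReal_nonneg

theorem MemBV.neg_integral_le {q : ℝ → ℝ} (hq : MemBV q) {φ : ℝ → ℝ} (hφ : IsTestFunction φ)
    (h1 : ∀ x, |φ x| ≤ 1) : - ∫ x, q x * deriv φ x ∂volΩ ≤ totalVar q := by
  have : ENNReal.ofReal (- ∫ x, q x * deriv φ x ∂volΩ) ≤ derivMeasureNorm q :=
    le_iSup₂_of_le φ ⟨hφ, h1⟩ le_rfl
  exact (ENNReal.ofReal_le_iff_le_toReal hq.2.ne).1 this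

theorem derivMeasureNorm_le {q : ℝ → ℝ} {C : ℝ}
    (h : ∀ φ, IsTestFunction φ → (∀ x, |φ x| ≤ 1) → - ∫ x, q x * deriv φ x ∂volΩ ≤ C) :
    derivMeasureNorm q ≤ ENNReal.ofReal C :=
  iSup₂_le fun φ hφ => ENNReal.ofReal_le_ofReal (h φ hφ.1 hφ.2)

theorem memBV_of_forall {q : ℝ → ℝ} {C : ℝ} (hC : 0 ≤ C) (hq : Integrable q volΩ)
    (h : ∀ φ, IsTestFunction φ → (∀ x, |φ x| ≤ 1) → - ∫ x, q x * deriv φ x ∂volΩ ≤ C) :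
    MemBV q ∧ totalVar q ≤ C :=
  ⟨⟨hq, (derivMeasureNorm_le h).trans_lt ENNReal.ofReal_lt_top⟩,
    ENNReal.toReal_le_of_le_ofReal hC (derivMeasureNorm_le h)⟩

theorem integrable_mul_deriv {q : ℝ → ℝ} (hq : Integrable q volΩ) {φ : ℝ → ℝ}
    (hφ : IsTestFunction φ) : Integrable (fun x => q x * deriv φ x) volΩ := by
  have h := hφ.memLp_deriv ⊤
  exact hq.mul_of_top_left h

theorem MemBV.add_smul {p q : ℝ → ℝ} (hp : MemBV p) (hq : MemBV q) {s t : ℝ} (hs : 0 ≤ s)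
    (ht : 0 ≤ t) : MemBV (fun x => s * p x + t * q x) ∧
      totalVar (fun x => s * p x + t * q x) ≤ s * totalVar p + t * totalVar q := by
  refine memBV_of_forall
    (add_nonneg (mul_nonneg hs (totalVar_nonneg p)) (mul_nonneg ht (totalVar_nonneg q)))
    ((hp.1.const_mul s).add (hq.1.const_mul t)) fun φ hφ h1 => ?_
  have h2 := mul_le_mul_of_nonneg_left (hp.neg_integral_le hφ h1) hs
  have h3 := mul_le_mul_of_nonneg_left (hq.neg_integral_le hφ h1) ht
  have h4 : ∫ x, (s * p x + t * q x) * deriv φ x ∂volΩ =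
      s * ∫ x, p x * deriv φ x ∂volΩ + t * ∫ x, q x * deriv φ x ∂volΩ := by
    simp_rw [add_mul, mul_assoc]
    rw [integral_add ((integrable_mul_deriv hp.1 hφ).const_mul s)
      ((integrable_mul_deriv hq.1 hφ).const_mul t), integral_const_mul, integral_const_mul]
  rw [h4]
  linarith

/-- Scale φ to the unit ball. As m may be 0, the bound is shown for positive m first and then
reached by enlarging m slightly. -/
theorem MemBV.abs_integral_le {q : ℝ → ℝ} (hq : MemBV q) {φ : ℝ → ℝ} (hφ : IsTestFunction φ)
    {m : ℝ} (h1 : ∀ x, |φ x| ≤ m) : |∫ x, q x * deriv φ x ∂volΩ| ≤ m * totalVar q := by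
  have key : ∀ m : ℝ, 0 < m → (∀ x, |φ x| ≤ m) →
      |∫ x, q x * deriv φ x ∂volΩ| ≤ m * totalVar q := by
    intro m hm h1
    have hd : ∀ c : ℝ, deriv (fun x => c * φ x) = fun x => c * deriv φ x := fun c => by
      funext x
      exact deriv_const_mul c (hφ.1.differentiable (by simp) x)
    have h2 : ∀ c : ℝ, |c| = m⁻¹ → -(c * ∫ x, q x * deriv φ x ∂volΩ) ≤ totalVar q := by
      intro c hc
      have := hq.neg_integral_le (hφ.const_mul c) fun x => by
        rw [abs_mul, hc, inv_mul_le_iff₀ hm, mul_one]; exact h1 x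
      rw [hd] at this
      simp_rw [mul_left_comm _ c] at this
      rwa [integral_const_mul] at this
    have h3 := h2 m⁻¹ (abs_of_pos (by positivity))
    have h4 := h2 (-m⁻¹) (by rw [abs_neg]; exact abs_of_pos (by positivity))
    rw [abs_le]
    rw [neg_le, ← inv_mul_le_iff₀ hm, ← inv_mul_le_iff₀ hm]
    constructor <;> linarith
  have hm0 : 0 ≤ m := (abs_nonneg _).trans (h1 0)
  refine le_of_forall_pos_le_add fun ε hε => ?_
  refine (key (m + ε / (totalVar q + 1)) ?_ fun x => (h1 x).trans ?_).trans ?_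
  · have := totalVar_nonneg q
    positivity
  · have := totalVar_nonneg q
    exact le_add_of_nonneg_right (by positivity)
  · have := totalVar_nonneg q
    rw [add_mul, div_mul_eq_mul_div]
    gcongr
    rw [div_le_iff₀ (by positivity)]
    nlinarith

/-- The difference of two probability densities has mean zero, so it is the derivative of a test
function, and that primitive is bounded by the L¹ norm, at most 2. -/
theorem MemBV.abs_integral_mul_test_sub_le {q : ℝ → ℝ} (hq : MemBV q) {ψ : ℝ → ℝ}
    (hψ : IsTestFunction ψ) (hψ0 : ∀ x, 0 ≤ ψ x) (hψ1 : ∫ x, ψ x ∂volΩ = 1) {g : ℝ → ℝ}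
    (hg : IsTestFunction g) (hg0 : ∀ x, 0 ≤ g x) (hg1 : ∫ x, g x ∂volΩ = 1) :
    |(∫ x, q x * g x ∂volΩ) - ∫ x, q x * ψ x ∂volΩ| ≤ 2 * totalVar q := by
  have ht : IsTestFunction fun x => g x + (-1) * ψ x := hg.add (hψ.const_mul _)
  have hgi := integrable_of_memLp_two (hg.memLp 2)
  have hψi := integrable_of_memLp_two (hψ.memLp 2)
  have ht0 : ∫ x, g x + (-1) * ψ x ∂volΩ = 0 := by
    rw [integral_add hgi (hψi.const_mul _), integral_const_mul, hψ1, hg1]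
    ring
  have h1 := hq.abs_integral_le (ht.prim ht0) (m := 2) fun x => by
    refine (abs_prim_le_integral (integrable_of_memLp_two (ht.memLp 2)) x).trans ?_
    calc ∫ x, |g x + (-1) * ψ x| ∂volΩ ≤ ∫ x, g x + ψ x ∂volΩ := by
          refine integral_mono (integrable_of_memLp_two (ht.memLp 2)).abs (hgi.add hψi)
            fun x => ?_
          have := hg0 x; have := hψ0 x
          rw [abs_le]; constructor <;> simp only <;> linarith
      _ = 2 := by rw [integral_add hgi hψi, hψ1, hg1]; norm_num
  rw [ht.deriv_prim] at h1
  refine le_trans (le_of_eq ?_) h1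
  have e := integral_sub (hq.1.mul_of_top_left (hg.memLp ⊤)) (hq.1.mul_of_top_left (hψ.memLp ⊤))
  simp only [Pi.mul_apply] at e
  rw [← e]
  congr 1
  apply integral_congr_ae
  exact .of_forall fun x => by ring

/-- Functions of bounded variation are essentially bounded, up to a constant, by their total
variation. -/
theorem MemBV.exists_ae_abs_sub_le {q : ℝ → ℝ} (hq : MemBV q) :
    ∃ c : ℝ, ∀ᵐ x ∂volΩ, |q x - c| ≤ 2 * totalVar q := by
  obtain ⟨ψ, hψ, hψ0, hψ1⟩ := exists_test_integral_eq_one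
  refine ⟨∫ x, q x * ψ x ∂volΩ, ?_⟩
  -- Mollification: at almost every x the averages of q against bumps centred at x converge to q x,
  -- and each average is within 2 TV(q) of the fixed one.
  let ρ : ℕ → ContDiffBump (0 : ℝ) := fun n =>
    ⟨1 / (n + 1) / 2, 1 / (n + 1), by positivity, half_lt_self (by positivity)⟩
  have hρ0 : Tendsto (fun n => (ρ n).rOut) atTop (𝓝 0) := tendsto_one_div_add_atTop_nhds_zero_nat
  have hq1 : Integrable ((Ioo (0 : ℝ) 1).indicator q) volume :=
    (integrable_indicator_iff measurableSet_Ioo).2 hq.1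
  have hlim := ContDiffBump.ae_convolution_tendsto_right_of_locallyIntegrable
    (μ := (volume : Measure ℝ)) (φ := ρ) (l := atTop) (K := 2) hρ0
    (.of_forall fun n => by change (1 / ((n : ℝ) + 1)) ≤ 2 * (1 / (n + 1) / 2); linarith)
    hq1.locallyIntegrable
  filter_upwards [ae_restrict_of_ae hlim, ae_volΩ_mem] with x hx hx01
  rw [indicator_of_mem hx01] at hx
  refine le_of_tendsto ((hx.sub_const (∫ x, q x * ψ x ∂volΩ)).abs) ?_
  -- For large n the bump around x is supported inside Ω, hence is an admissible test function.
  have hev : ∀ᶠ n in atTop, (ρ n).rOut < min x (1 - x) :=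
    hρ0.eventually_lt_const (lt_min hx01.1 (sub_pos.2 hx01.2))
  filter_upwards [hev] with n hn
  have hg0 : ∀ t, 0 ≤ (ρ n).normed volume (x - t) := fun t => (ρ n).nonneg_normed _
  have hcl : tsupport (fun t => (ρ n).normed volume (x - t)) ⊆
      Metric.closedBall x (ρ n).rOut := by
    refine closure_minimal (fun t ht => ?_) Metric.isClosed_closedBall
    have h2 : x - t ∈ tsupport ((ρ n).normed volume) := subset_tsupport _ ht
    rw [(ρ n).tsupport_normed_eq] at h2
    rw [Metric.mem_closedBall, dist_comm, Real.dist_eq]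
    simpa using h2
  have hg : IsTestFunction fun t => (ρ n).normed volume (x - t) := by
    refine ⟨(ρ n).contDiff_normed.comp (contDiff_const.sub contDiff_id),
      HasCompactSupport.of_support_subset_isCompact (isCompact_closedBall x (ρ n).rOut)
        ((subset_tsupport _).trans hcl), hcl.trans fun t ht => ?_⟩
    rw [Real.closedBall_eq_Icc] at ht
    have h3 := min_le_left x (1 - x)
    have h4 := min_le_right x (1 - x)
    constructor <;> linarith [ht.1, ht.2]
  have hg1 : ∫ t, (ρ n).normed volume (x - t) ∂volΩ = 1 := by
    rw [integral_volΩ_of_support ((subset_tsupport _).trans hg.2.2)]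
    rw [integral_sub_left_eq_self (fun t => (ρ n).normed volume t) volume x]
    exact (ρ n).integral_normed
  have := hq.abs_integral_mul_test_sub_le hψ hψ0 hψ1 hg hg0 hg1
  refine le_trans (le_of_eq ?_) this
  congr 2
  rw [convolution_eq_swap, volΩ, ← integral_indicator measurableSet_Ioo]
  congr 1
  funext t
  by_cases ht : t ∈ Ioo (0 : ℝ) 1
  · simp [ht, mul_comm]
  · simp [ht]

theorem MemBV.memLp {q : ℝ → ℝ} (hq : MemBV q) (p : ℝ≥0∞) : MemLp q p volΩ := by
  obtain ⟨c, hc⟩ := hq.exists_ae_abs_sub_le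
  refine MemLp.of_bound hq.1.aestronglyMeasurable (|c| + 2 * totalVar q) ?_
  filter_upwards [hc] with x hx
  rw [Real.norm_eq_abs]
  have := abs_add_le (q x - c) c
  rw [sub_add_cancel] at this
  linarith

/-- The total variation controls the pairing with all functions of mean value zero whose
primitive is bounded. -/
theorem MemBV.abs_integral_mul_le {q : ℝ → ℝ} (hq : MemBV q) {g : L2Ω} (hg : g ∈ meanZero)
    {m : ℝ} (hm : ∀ x, |prim g x| ≤ m) : |∫ x, q x * g x ∂volΩ| ≤ m * totalVar q := by
  set Q := (hq.memLp 2).toLp q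
  have hTV := totalVar_nonneg q
  have hQ := norm_nonneg Q
  refine le_of_forall_pos_le_add fun ε' hε' => ?_
  -- Replacing g by φ' costs ‖Q‖ ε in the pairing and raises the sup bound on the primitive by ε,
  -- which costs another ε TV(q).
  set ε := ε' / (‖Q‖ + totalVar q + 1) with hε
  have hεpos : 0 < ε := by positivity
  obtain ⟨φ, hφ, h1⟩ := exists_test_norm_sub_deriv_lt hg hεpos
  have h2 : ∀ x, |φ x| ≤ m + ε := by
    intro x
    have h3 := abs_prim_le (g - (hφ.memLp_deriv 2).toLp _) x
    rw [prim_congr (Lp.coeFn_sub _ _)] at h3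
    have h4 := prim_sub (integrable_L2Ω g) (integrable_L2Ω ((hφ.memLp_deriv 2).toLp _)) x
    rw [prim_congr (hφ.memLp_deriv 2).coeFn_toLp, hφ.prim_deriv] at h4
    have h5 : |prim g x - φ x| ≤ ε := by
      rw [← h4]
      exact h3.trans h1.le
    have h6 := abs_sub_abs_le_abs_sub (φ x) (prim g x)
    rw [abs_sub_comm] at h6
    linarith [hm x]
  have h3 := hq.abs_integral_le hφ h2
  have h4 : |inner ℝ Q (g - (hφ.memLp_deriv 2).toLp _)| ≤ ‖Q‖ * ε :=
    (abs_real_inner_le_norm _ _).trans (mul_le_mul_of_nonneg_left h1.le hQ)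
  rw [inner_sub_right, inner_toLp, inner_toLp_left] at h4
  have h5 := abs_sub_abs_le_abs_sub (∫ x, q x * g x ∂volΩ) (∫ x, q x * deriv φ x ∂volΩ)
  have h6 : ε' = ε * (‖Q‖ + totalVar q + 1) := by rw [hε]; field_simp
  rw [h6]
  nlinarith

/-! ### Meshes and the cellwise averaging projection. -/

namespace Mesh

variable (T : Mesh)

theorem node_mem (i : Fin (T.l + 1)) : T.node i ∈ Icc (0 : ℝ) 1 := by
  rw [← T.node_zero, ← T.node_last]
  exact ⟨T.strictMono.monotone (Fin.zero_le i), T.strictMono.monotone (Fin.le_last i)⟩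

/-- The length of a cell. -/
def len (i : Fin T.l) : ℝ := T.node i.succ - T.node i.castSucc

theorem len_pos (i : Fin T.l) : 0 < T.len i :=
  sub_pos.2 (T.strictMono (Fin.castSucc_lt_succ))

theorem len_le_width (i : Fin T.l) : T.len i ≤ T.width :=
  le_ciSup (f := fun i : Fin T.l => T.node i.succ - T.node i.castSucc)
    (Set.finite_range _).bddAbove i

theorem width_pos : 0 < T.width :=
  (T.len_pos ⟨0, zero_lt_one.trans T.one_lt⟩).trans_le (T.len_le_width _)

theorem cell_subset (i : Fin T.l) : T.cell i ⊆ Ioo 0 1 :=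
  Ioo_subset_Ioo (T.node_mem _).1 (T.node_mem _).2

theorem measurableSet_cell (i : Fin T.l) : MeasurableSet (T.cell i) := measurableSet_Ioo

theorem volume_real_cell (i : Fin T.l) : volume.real (T.cell i) = T.len i := by
  rw [cell, Real.volume_real_Ioo_of_le (T.strictMono (Fin.castSucc_lt_succ)).le]
  rfl

theorem exists_mem_Icc {x : ℝ} (hx : x ∈ Icc (0 : ℝ) 1) :
    ∃ i : Fin T.l, x ∈ Icc (T.node i.castSucc) (T.node i.succ) := by
  have key : ∀ j : Fin (T.l + 1), x ≤ T.node j →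
      x = 0 ∨ ∃ i : Fin T.l, x ∈ Icc (T.node i.castSucc) (T.node i.succ) := by
    intro j
    induction j using Fin.induction with
    | zero => exact fun h => .inl (le_antisymm (by rwa [T.node_zero] at h) hx.1)
    | succ i ih =>
      intro h
      rcases le_total x (T.node i.castSucc) with h' | h'
      · exact ih h'
      · exact .inr ⟨i, h', h⟩
  rcases key (Fin.last _) (by rw [T.node_last]; exact hx.2) with h | h
  · refine ⟨⟨0, zero_lt_one.trans T.one_lt⟩, ?_, ?_⟩
    · rw [show (Fin.castSucc ⟨0, zero_lt_one.trans T.one_lt⟩ : Fin (T.l + 1)) = 0 from rfl,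
        T.node_zero]
      exact hx.1
    · rw [h]; exact (T.node_mem _).1
  · exact h

theorem cell_disjoint {i j : Fin T.l} (hij : i ≠ j) : Disjoint (T.cell i) (T.cell j) := by
  wlog h : i < j generalizing i j
  · exact (this hij.symm (lt_of_le_of_ne (not_lt.1 h) hij.symm)).symm
  rw [Set.disjoint_left]
  intro x hx hx'
  have : T.node i.succ ≤ T.node j.castSucc :=
    T.strictMono.monotone (by simpa [Fin.le_def] using h)
  linarith [hx.2, hx'.1]

theorem ae_mem_cell : ∀ᵐ x ∂volΩ, ∃ i, x ∈ T.cell i := by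
  have h0 : volΩ (Set.range T.node) = 0 := (Set.finite_range _).measure_zero _
  filter_upwards [ae_volΩ_mem, measure_eq_zero_iff_ae_notMem.1 h0] with x hx hx'
  obtain ⟨i, hi⟩ := T.exists_mem_Icc (Ioo_subset_Icc_self hx)
  refine ⟨i, lt_of_le_of_ne hi.1 fun h => hx' ⟨_, h⟩, lt_of_le_of_ne hi.2 fun h => hx' ⟨_, h.symm⟩⟩

theorem ae_of_forall_cell {p : ℝ → Prop} (h : ∀ i, ∀ᵐ x ∂(volume.restrict (T.cell i)), p x) :
    ∀ᵐ x ∂volΩ, p x := by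
  have h1 : ∀ᵐ x ∂volΩ, ∀ i, x ∈ T.cell i → p x := by
    rw [ae_all_iff]
    exact fun i => ae_restrict_of_ae ((ae_restrict_iff' (T.measurableSet_cell i)).1 (h i))
  filter_upwards [h1, T.ae_mem_cell] with x hx ⟨i, hi⟩ using hx i hi

theorem ae_restrict_cell {p : ℝ → Prop} (h : ∀ᵐ x ∂volΩ, p x) (i : Fin T.l) :
    ∀ᵐ x ∂(volume.restrict (T.cell i)), p x :=
  ae_mono (Measure.restrict_mono (T.cell_subset i) le_rfl) h

theorem integral_eq_sum {f : ℝ → ℝ} (hf : Integrable f volΩ) :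
    ∫ x, f x ∂volΩ = ∑ i, ∫ x in T.cell i, f x := by
  have h : volΩ = volume.restrict (⋃ i, T.cell i) := by
    refine Measure.restrict_congr_set (Filter.EventuallyEq.symm ?_)
    refine Filter.EventuallyLE.antisymm
      (LE.le.eventuallyLE (iUnion_subset T.cell_subset)) ?_
    have := (ae_restrict_iff' measurableSet_Ioo).1 T.ae_mem_cell
    filter_upwards [this] with x hx hx'
    exact mem_iUnion.2 (hx hx')
  rw [h, integral_iUnion_fintype T.measurableSet_cell fun i j hij => T.cell_disjoint hij]
  exact fun i => IntegrableOn.mono_set hf (T.cell_subset i)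

/-- The function with value `c i` on the `i`-th cell. -/
def stepFun (c : Fin T.l → ℝ) (x : ℝ) : ℝ := ∑ i, (T.cell i).indicator (fun _ => c i) x

theorem stepFun_of_mem (c : Fin T.l → ℝ) {i : Fin T.l} {x : ℝ} (hx : x ∈ T.cell i) :
    T.stepFun c x = c i := by
  rw [stepFun, Finset.sum_eq_single i, indicator_of_mem hx]
  · exact fun j _ hj => indicator_of_notMem
      (fun h => Set.disjoint_left.1 (T.cell_disjoint hj) h hx) _
  · simp

theorem memLp_stepFun (c : Fin T.l → ℝ) (p : ℝ≥0∞) : MemLp (T.stepFun c) p volΩ :=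
  memLp_finsetSum _ fun i _ => (memLp_const (c i)).indicator (T.measurableSet_cell i)

/-- The mean value of `f` on a cell. -/
def avg (f : ℝ → ℝ) (i : Fin T.l) : ℝ := (T.len i)⁻¹ * ∫ x in T.cell i, f x

/-- The `L²`-orthogonal projection onto the cellwise constant functions. -/
def proj (f : ℝ → ℝ) : ℝ → ℝ := T.stepFun (T.avg f)

theorem setIntegral_mul_stepFun (f : ℝ → ℝ) (c : Fin T.l → ℝ) (i : Fin T.l) :
    ∫ x in T.cell i, f x * T.stepFun c x = (∫ x in T.cell i, f x) * c i := by
  rw [← integral_mul_const]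
  exact setIntegral_congr_fun (T.measurableSet_cell i) fun x hx => by
    simp only [T.stepFun_of_mem c hx]

theorem integral_mul_proj {f g : ℝ → ℝ} (hf : Integrable f volΩ) (hg : Integrable g volΩ) :
    ∫ x, T.proj f x * g x ∂volΩ = ∫ x, f x * T.proj g x ∂volΩ := by
  have h1 : Integrable (fun x => f x * T.proj g x) volΩ :=
    hf.mul_of_top_left (T.memLp_stepFun _ ⊤)
  have h2 : Integrable (fun x => g x * T.proj f x) volΩ :=
    hg.mul_of_top_left (T.memLp_stepFun _ ⊤)
  simp_rw [mul_comm (T.proj f _)]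
  rw [T.integral_eq_sum h1, T.integral_eq_sum h2]
  refine Finset.sum_congr rfl fun i _ => ?_
  rw [proj, proj, T.setIntegral_mul_stepFun, T.setIntegral_mul_stepFun, avg, avg]
  ring

theorem prim_sub_node {g : ℝ → ℝ} (hg : Integrable g volΩ) {c : Fin T.l → ℝ}
    (hc : g =ᵐ[volΩ] T.stepFun c) {i : Fin T.l} {x : ℝ}
    (hx : x ∈ Icc (T.node i.castSucc) (T.node i.succ)) :
    prim g x - prim g (T.node i.castSucc) = (x - T.node i.castSucc) * c i := by
  have hsub : Ioo (T.node i.castSucc) x ⊆ T.cell i := Ioo_subset_Ioo le_rfl hx.2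
  rw [prim_sub_prim' hg (T.node_mem _).1 hx.1 (hx.2.trans (T.node_mem _).2)]
  rw [← Real.volume_real_Ioo_of_le hx.1, ← smul_eq_mul, ← setIntegral_const]
  refine setIntegral_congr_ae measurableSet_Ioo ?_
  have := (ae_restrict_iff' (T.measurableSet_cell i)).1 (T.ae_restrict_cell hc i)
  filter_upwards [this] with t ht ht'
  rw [ht (hsub ht'), T.stepFun_of_mem c (hsub ht')]

theorem integrable_proj (g : ℝ → ℝ) : Integrable (T.proj g) volΩ :=
  integrable_of_memLp_two (T.memLp_stepFun _ 2)

theorem prim_succ_sub {g : ℝ → ℝ} (hg : Integrable g volΩ) (i : Fin T.l) :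
    prim g (T.node i.succ) - prim g (T.node i.castSucc) = T.len i * T.avg g i := by
  rw [prim_sub_prim' hg (T.node_mem _).1 (T.strictMono (Fin.castSucc_lt_succ)).le
    (T.node_mem _).2, avg, mul_inv_cancel_left₀ (T.len_pos i).ne']
  rfl

/-- Averaging preserves the integral over each cell, so the primitive of the projection agrees with
the original primitive at all nodes. -/
theorem prim_proj_node {g : ℝ → ℝ} (hg : Integrable g volΩ) (i : Fin (T.l + 1)) :
    prim (T.proj g) (T.node i) = prim g (T.node i) := by
  induction i using Fin.induction with
  | zero => rw [T.node_zero, prim_of_nonpos _ le_rfl, prim_of_nonpos _ le_rfl]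
  | succ i ih =>
    have h1 := T.prim_succ_sub hg i
    have h2 := T.prim_sub_node (T.integrable_proj g) (c := T.avg g) .rfl
      (right_mem_Icc.2 (T.strictMono (Fin.castSucc_lt_succ (i := i))).le)
    change _ = T.len i * _ at h2
    linarith

theorem integral_proj {g : ℝ → ℝ} (hg : Integrable g volΩ) :
    ∫ x, T.proj g x ∂volΩ = ∫ x, g x ∂volΩ := by
  rw [← prim_of_one_le _ le_rfl, ← prim_of_one_le g le_rfl, ← T.node_last, T.prim_proj_node hg]

theorem abs_prim_le_of_forall_mem {g : ℝ → ℝ} {m : ℝ} (hm : 0 ≤ m)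
    (h : ∀ i : Fin T.l, ∀ x ∈ Icc (T.node i.castSucc) (T.node i.succ), |prim g x| ≤ m) (x : ℝ) :
    |prim g x| ≤ m := by
  have h01 : ∀ x ∈ Icc (0 : ℝ) 1, |prim g x| ≤ m := fun x hx => by
    obtain ⟨i, hi⟩ := T.exists_mem_Icc hx
    exact h i x hi
  rcases le_total x 0 with h0 | h0
  · rwa [prim_of_nonpos _ h0, abs_zero]
  · rcases le_total x 1 with h1 | h1
    · exact h01 x ⟨h0, h1⟩
    · rw [prim_of_one_le _ h1, ← prim_of_one_le g le_rfl]
      exact h01 1 ⟨zero_le_one, le_rfl⟩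

/-- On a cell the primitive of the projection is the linear interpolant of the nodal values of `prim
g`, hence a convex combination of two of them. -/
theorem abs_prim_proj_le {g : ℝ → ℝ} (hg : Integrable g volΩ) {m : ℝ}
    (h : ∀ x, |prim g x| ≤ m) (x : ℝ) : |prim (T.proj g) x| ≤ m := by
  refine T.abs_prim_le_of_forall_mem ((abs_nonneg _).trans (h 0)) (fun i x hx => ?_) x
  have h1 := T.prim_succ_sub hg i
  have h2 := T.prim_sub_node (T.integrable_proj g) (c := T.avg g) .rfl hx
  rw [T.prim_proj_node hg] at h2
  have hlen := T.len_pos i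
  set θ := (x - T.node i.castSucc) / T.len i with hθ
  have hθ1 : x - T.node i.castSucc = θ * T.len i := by rw [hθ]; field_simp
  have hθ0 : 0 ≤ θ := div_nonneg (sub_nonneg.2 hx.1) hlen.le
  have hθ2 : θ ≤ 1 := by
    rw [hθ, div_le_one hlen]
    exact sub_le_sub_right hx.2 _
  have h3 : prim (T.proj g) x =
      (1 - θ) * prim g (T.node i.castSucc) + θ * prim g (T.node i.succ) := by
    rw [hθ1, mul_assoc, ← h1] at h2
    linarith
  have ha := abs_le.1 (h (T.node i.castSucc))
  have hb := abs_le.1 (h (T.node i.succ))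
  rw [h3, abs_le]
  constructor <;> nlinarith

/-- By duality ∫ Pq φ' = ∫ q Pφ', and the primitive of Pφ' is the nodal interpolant of φ, still
bounded by 1. It need not be smooth, which is why `MemBV.abs_integral_mul_le` allows general
mean-zero functions. -/
theorem memBV_proj {q : ℝ → ℝ} (hq : MemBV q) :
    MemBV (T.proj q) ∧ totalVar (T.proj q) ≤ totalVar q := by
  refine memBV_of_forall (totalVar_nonneg q) (T.integrable_proj q) fun φ hφ h1 => ?_
  have hφi := integrable_of_memLp_two (hφ.memLp_deriv 2)
  rw [T.integral_mul_proj hq.1 hφi]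
  have hL := T.memLp_stepFun (T.avg (deriv φ)) 2
  have hmean : hL.toLp _ ∈ meanZero := by
    rw [mem_meanZero, integral_congr_ae hL.coeFn_toLp]
    exact (T.integral_proj hφi).trans hφ.integral_deriv
  have h2 := hq.abs_integral_mul_le hmean (m := 1) fun x => by
    rw [prim_congr hL.coeFn_toLp]
    exact T.abs_prim_proj_le hφi (fun x => by rw [hφ.prim_deriv]; exact h1 x) x
  have h3 : ∫ x, q x * hL.toLp _ x ∂volΩ = ∫ x, q x * T.proj (deriv φ) x ∂volΩ := by
    apply integral_congr_ae
    filter_upwards [hL.coeFn_toLp] with x hx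
    rw [hx]; rfl
  rw [h3, one_mul] at h2
  exact (neg_le_abs _).trans h2

theorem abs_avg_sub_le {f : ℝ → ℝ} (hf : Integrable f volΩ) {i : Fin T.l} {y C : ℝ}
    (h : ∀ x ∈ T.cell i, |f x - f y| ≤ C) : |T.avg f i - f y| ≤ C := by
  have hlen := T.len_pos i
  have hfi : IntegrableOn f (T.cell i) := IntegrableOn.mono_set hf (T.cell_subset i)
  have h1 : T.avg f i - f y = (T.len i)⁻¹ * ∫ x in T.cell i, (f x - f y) := by
    rw [integral_sub hfi (integrableOn_const (by simp [cell])), setIntegral_const,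
      T.volume_real_cell, avg, smul_eq_mul]
    field_simp
  have h2 : ‖∫ x in T.cell i, (f x - f y)‖ ≤ C * volume.real (T.cell i) :=
    norm_setIntegral_le_of_norm_le_const (by simp [cell]) h
  rw [T.volume_real_cell, Real.norm_eq_abs] at h2
  rw [h1, abs_mul, abs_of_pos (inv_pos.2 hlen), inv_mul_le_iff₀ hlen, mul_comm]
  exact h2

theorem abs_proj_sub_le {f : ℝ → ℝ} (hf : Integrable f volΩ) {D : ℝ} (hD : 0 ≤ D)
    (h : ∀ x ∈ Ioo (0 : ℝ) 1, ∀ y ∈ Ioo (0 : ℝ) 1, |f x - f y| ≤ D * |x - y|) {i : Fin T.l}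
    {y : ℝ} (hy : y ∈ T.cell i) : |T.proj f y - f y| ≤ D * T.width := by
  rw [proj, T.stepFun_of_mem _ hy]
  refine T.abs_avg_sub_le hf fun x hx => (h x (T.cell_subset i hx) y (T.cell_subset i hy)).trans ?_
  refine mul_le_mul_of_nonneg_left (le_trans ?_ (T.len_le_width i)) hD
  rw [abs_le, len]
  constructor <;> linarith [hx.1, hx.2, hy.1, hy.2]

/-- One factor h comes from |Pp − p| ≤ D h. The other comes from integrating over less than a cell,
since the primitive of Pp − p vanishes at every node. -/
theorem abs_integral_mul_proj_sub_le {q p : ℝ → ℝ} (hq : MemBV q) (hp : MemLp p 2 volΩ) {D : ℝ}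
    (hD : 0 ≤ D) (h : ∀ x ∈ Ioo (0 : ℝ) 1, ∀ y ∈ Ioo (0 : ℝ) 1, |p x - p y| ≤ D * |x - y|) :
    |∫ x, q x * (T.proj p x - p x) ∂volΩ| ≤ D * T.width ^ 2 * totalVar q := by
  have hpi := integrable_of_memLp_two hp
  have hL : MemLp (fun x => T.proj p x - p x) 2 volΩ := (T.memLp_stepFun _ 2).sub hp
  have hLi := integrable_of_memLp_two hL
  have hnode : ∀ i, prim (fun x => T.proj p x - p x) (T.node i) = 0 := fun i => by
    rw [prim_sub (T.integrable_proj p) hpi, T.prim_proj_node hpi, sub_self]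
  have hmean : hL.toLp _ ∈ meanZero := by
    rw [mem_meanZero, integral_congr_ae hL.coeFn_toLp, ← prim_of_one_le _ le_rfl, ← T.node_last]
    exact hnode _
  have hw := T.width_pos.le
  have h2 := hq.abs_integral_mul_le hmean (m := D * T.width ^ 2) fun x => by
    rw [prim_congr hL.coeFn_toLp]
    refine T.abs_prim_le_of_forall_mem (by positivity) (fun i x hx => ?_) x
    rw [← sub_zero (prim _ x), ← hnode i.castSucc,
      prim_sub_prim' hLi (T.node_mem _).1 hx.1 (hx.2.trans (T.node_mem _).2)]
    have h3 := norm_setIntegral_le_of_norm_le_const (μ := volume)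
      (s := Ioo (T.node i.castSucc) x) (f := fun x => T.proj p x - p x) (C := D * T.width)
      (by simp) fun t ht =>
        T.abs_proj_sub_le hpi hD h (i := i) ⟨ht.1, ht.2.trans_le hx.2⟩
    rw [Real.volume_real_Ioo_of_le hx.1] at h3
    refine h3.trans ?_
    rw [sq, ← mul_assoc]
    refine mul_le_mul_of_nonneg_left (le_trans ?_ (T.len_le_width i)) (by positivity)
    exact sub_le_sub_right hx.2 _
  have h3 : ∫ x, q x * hL.toLp _ x ∂volΩ = ∫ x, q x * (T.proj p x - p x) ∂volΩ := by
    apply integral_congr_ae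
    filter_upwards [hL.coeFn_toLp] with x hx
    rw [hx]
  rwa [h3] at h2

/-! ### The space V_h in terms of derivatives. -/

/-- The cellwise constant functions in `L²(Ω)` as the range of a linear map. -/
def stepL : (Fin T.l → ℝ) →ₗ[ℝ] L2Ω where
  toFun c := (T.memLp_stepFun c 2).toLp _
  map_add' c d := by
    rw [← MemLp.toLp_add]
    apply MemLp.toLp_congr
    filter_upwards [T.ae_mem_cell] with x ⟨i, hi⟩
    simp [T.stepFun_of_mem _ hi]
  map_smul' r c := by
    rw [RingHom.id_apply, ← MemLp.toLp_const_smul]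
    apply MemLp.toLp_congr
    filter_upwards [T.ae_mem_cell] with x ⟨i, hi⟩
    simp [T.stepFun_of_mem _ hi]

/-- The cellwise constant functions with mean value zero, the derivatives of the elements of
`V_h`. -/
def gradSpace : Submodule ℝ L2Ω := LinearMap.range T.stepL ⊓ meanZero

instance : CompleteSpace T.gradSpace := by
  unfold gradSpace
  exact FiniteDimensional.complete ℝ _

theorem gradSpace_le : T.gradSpace ≤ meanZero := inf_le_right

theorem mem_gradSpace {g : L2Ω} :
    g ∈ T.gradSpace ↔ g ∈ meanZero ∧ ∃ c, g =ᵐ[volΩ] T.stepFun c := by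
  rw [gradSpace, Submodule.mem_inf, and_comm, LinearMap.mem_range]
  refine and_congr_right fun _ => exists_congr fun c => ?_
  constructor
  · rintro rfl
    exact (T.memLp_stepFun c 2).coeFn_toLp
  · exact fun h => Lp.ext ((T.memLp_stepFun c 2).coeFn_toLp.trans h.symm)

theorem exists_ae_eq_stepFun {f : ℝ → ℝ}
    (h : ∀ i : Fin T.l, ∃ c : ℝ, ∀ᵐ x ∂(volume.restrict (T.cell i)), f x = c) :
    ∃ c, f =ᵐ[volΩ] T.stepFun c := by
  choose c hc using h
  refine ⟨c, T.ae_of_forall_cell fun i => ?_⟩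
  filter_upwards [hc i, ae_restrict_mem (T.measurableSet_cell i)] with x hx hxi
  rw [hx, T.stepFun_of_mem c hxi]

theorem memVh_prim {g : L2Ω} (hg : g ∈ T.gradSpace) : MemVh T (prim g) := by
  obtain ⟨hg0, c, hc⟩ := T.mem_gradSpace.1 hg
  refine ⟨(memH10_of_ae_eq_prim hg0 .rfl).1, (continuous_prim (integrable_L2Ω g)).continuousOn,
    prim_of_nonpos _ le_rfl, ?_, fun i => ⟨c i,
      prim g (T.node i.castSucc) - T.node i.castSucc * c i, fun x hx => ?_⟩⟩
  · rw [prim_of_one_le _ le_rfl]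
    exact mem_meanZero.1 hg0
  · have := T.prim_sub_node (integrable_L2Ω g) hc (Ioo_subset_Icc_self hx)
    linarith

end Mesh

/-- Test the weak derivative with functions supported in one cell: integrating the affine function
by parts identifies the derivative there with the slope m. -/
theorem MemVh.grad_mem {T : Mesh} {v : ℝ → ℝ} (h : MemVh T v) : h.1.grad ∈ T.gradSpace := by
  refine T.mem_gradSpace.2 ⟨h.1.grad_mem, T.exists_ae_eq_stepFun fun i => ?_⟩
  obtain ⟨m, b, hmb⟩ := h.2.2.2.2 i
  refine ⟨m, ?_⟩
  have hint : Integrable (fun x => h.1.grad x - m) volΩ :=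
    (integrable_L2Ω _).sub (integrable_const m)
  have := isOpen_Ioo.ae_eq_zero_of_integral_contDiff_smul_eq_zero
    (locallyIntegrableOn_of_integrable hint (T.cell_subset i)) fun φ h1 h2 h3 => by
      have hφ : IsTestFunction φ := ⟨h1, h2, h3.trans (T.cell_subset i)⟩
      have hsupp : Function.support (fun x => φ x • (h.1.grad x - m)) ⊆ Ioo 0 1 :=
        fun x hx => hφ.2.2 (subset_tsupport _ (left_ne_zero_of_mul hx))
      rw [← integral_volΩ_of_support hsupp]
      have e1 := isWeakDeriv_of_ae_eq_prim h.1.ae_eq_prim φ hφ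
      have hlin : ContDiff ℝ ∞ fun x : ℝ => m * x + b := by fun_prop
      have e2 := hφ.integral_mul_deriv hlin
      have e3 : ∫ x, v x * deriv φ x ∂volΩ = ∫ x, (m * x + b) * deriv φ x ∂volΩ := by
        congr 1
        funext x
        by_cases hx : x ∈ T.cell i
        · rw [hmb x hx]
        · have : deriv φ x = 0 := by
            by_contra h'
            exact hx (h3 (tsupport_deriv_subset (𝕜 := ℝ) (subset_tsupport _ h')))
          rw [this, mul_zero, mul_zero]
      have e4 : deriv (fun x : ℝ => m * x + b) = fun _ => m := by
        funext x
        simp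
      rw [e4] at e2
      simp_rw [smul_eq_mul, mul_sub, mul_comm (φ _)]
      rw [integral_sub]
      · linarith
      · exact (Lp.memLp _).integrable_mul (hφ.memLp 2)
      · exact (integrable_of_memLp_two (hφ.memLp 2)).const_mul m
  rw [ae_restrict_iff' (T.measurableSet_cell i)]
  filter_upwards [this] with x hx hxi
  exact sub_eq_zero.1 (hx hxi)

/-! ### Abstract Galerkin theory. -/

section Galerkin

variable {H : Type*} [NormedAddCommGroup H] [InnerProductSpace ℝ H] {B : H →L[ℝ] H →L[ℝ] ℝ}
  {ν : ℝ}

/-- Solvability of coercive variational problems on a complete subspace. -/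
theorem exists_galerkin (hν : 0 < ν) (hB : ∀ u, ν * ‖u‖ ^ 2 ≤ B u u) (M : Submodule ℝ H)
    [CompleteSpace M] (ℓ : H →L[ℝ] ℝ) : ∃ g ∈ M, ∀ k ∈ M, B g k = ℓ k := by
  -- Lax–Milgram on M, with the right-hand side represented by Riesz.
  have hc : IsCoercive (B.bilinearComp M.subtypeL M.subtypeL) :=
    ⟨ν, hν, fun u => by simpa [sq, mul_assoc] using hB u⟩
  set f : M := (InnerProductSpace.toDual ℝ M).symm (ℓ.comp M.subtypeL) with hf
  refine ⟨hc.continuousLinearEquivOfBilin.symm f, Subtype.mem _, fun k hk => ?_⟩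
  have h1 := hc.continuousLinearEquivOfBilin_apply (hc.continuousLinearEquivOfBilin.symm f) ⟨k, hk⟩
  rw [ContinuousLinearEquiv.apply_symm_apply, hf, InnerProductSpace.toDual_symm_apply] at h1
  simpa using h1.symm

/-- The Galerkin error, tested with a functional `ℓ'`, is controlled by the product of the best
approximation errors of the primal and of the dual solution. -/
theorem galerkin_pairing_le (hν : 0 < ν) (hB : ∀ u, ν * ‖u‖ ^ 2 ≤ B u u)
    (hsymm : ∀ u v, B u v = B v u) {M K : Submodule ℝ H} (hMK : M ≤ K) {ℓ ℓ' : H →L[ℝ] ℝ}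
    {g gh g' k k' : H} (hg : g ∈ K) (hgK : ∀ k ∈ K, B g k = ℓ k) (hgh : gh ∈ M)
    (hghM : ∀ k ∈ M, B gh k = ℓ k) (hgK' : ∀ k ∈ K, B g' k = ℓ' k)
    (hk : k ∈ M) (hk' : k' ∈ M) {δ δ' : ℝ} (h1 : ‖g - k‖ ≤ δ) (h2 : ‖g' - k'‖ ≤ δ') :
    |ℓ' (g - gh)| ≤ ‖B‖ ^ 2 / ν * δ * δ' := by
  have horth : ∀ m ∈ M, B (g - gh) m = 0 := fun m hm => by
    rw [map_sub, sub_apply, hgK m (hMK hm), hghM m hm, sub_self]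
  have hδ : 0 ≤ δ := (norm_nonneg _).trans h1
  have hδ' : 0 ≤ δ' := (norm_nonneg _).trans h2
  have hBn := norm_nonneg B
  have he0 := norm_nonneg (g - gh)
  -- Céa's argument: Galerkin orthogonality replaces gh by k in the second slot.
  have h3 : ν * ‖g - gh‖ ^ 2 ≤ ‖B‖ * ‖g - gh‖ * δ := by
    refine (hB _).trans ?_
    have e : B (g - gh) (g - gh) = B (g - gh) (g - k) := by
      rw [← sub_eq_zero, ← map_sub, show g - gh - (g - k) = k - gh by abel]
      exact horth _ (M.sub_mem hk hgh)
    rw [e]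
    refine (le_abs_self _).trans ((B.le_opNorm₂ _ _).trans ?_)
    gcongr
  have h4 : ‖g - gh‖ ≤ ‖B‖ * δ / ν := by
    rcases he0.eq_or_lt with h0 | h0
    · rw [← h0]; positivity
    · rw [le_div_iff₀ hν]
      nlinarith
  -- The Aubin–Nitsche step: g' represents ℓ', and by orthogonality k' may be subtracted.
  have h5 : ℓ' (g - gh) = B (g - gh) (g' - k') := by
    rw [← hgK' _ (K.sub_mem hg (hMK hgh)), hsymm, map_sub (B (g - gh)), horth k' hk', sub_zero]
  rw [h5]
  calc |B (g - gh) (g' - k')| ≤ ‖B‖ * ‖g - gh‖ * ‖g' - k'‖ := B.le_opNorm₂ _ _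
    _ ≤ ‖B‖ * (‖B‖ * δ / ν) * δ' := by gcongr
    _ = ‖B‖ ^ 2 / ν * δ * δ' := by ring

end Galerkin

/-! ### The energy form and solutions of the state equation. -/

/-- Multiplication by an essentially bounded function. -/
def mulL {f : ℝ → ℝ} (hf : MemLp f ⊤ volΩ) : L2Ω →L[ℝ] L2Ω :=
  (ContinuousLinearMap.mul ℝ ℝ).holderL volΩ ⊤ 2 2 (hf.toLp f)

theorem coeFn_mulL {f : ℝ → ℝ} (hf : MemLp f ⊤ volΩ) (g : L2Ω) :
    mulL hf g =ᵐ[volΩ] fun x => f x * g x := by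
  have h := (ContinuousLinearMap.mul ℝ ℝ).coeFn_holder (r := 2) (hf.toLp f) g
  refine EventuallyEq.trans h ?_
  filter_upwards [hf.coeFn_toLp] with x hx
  rw [hx]; rfl

/-- The assumptions on the coefficients of the state equation. -/
structure IsCoeff (ν : ℝ) (L : ℝ≥0) (a d : ℝ → ℝ) : Prop where
  pos : 0 < ν
  lip : LipschitzOnWith L a (Icc 0 1)
  le : ∀ x ∈ Icc (0 : ℝ) 1, ν ≤ a x
  bdd : MemLp d ⊤ volΩ
  nonneg : ∀ᵐ x ∂volΩ, 0 ≤ d x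

namespace IsCoeff

variable {ν : ℝ} {L : ℝ≥0} {a d : ℝ → ℝ}

theorem memLp (h : IsCoeff ν L a d) : MemLp a ⊤ volΩ := by
  obtain ⟨C, hC⟩ := (isCompact_Icc (a := (0 : ℝ)) (b := 1)).exists_bound_of_continuousOn
    h.lip.continuousOn
  refine MemLp.of_bound ((h.lip.continuousOn.mono Ioo_subset_Icc_self).aestronglyMeasurable
    measurableSet_Ioo) C ?_
  filter_upwards [ae_volΩ_mem] with x hx using hC x (Ioo_subset_Icc_self hx)

/-- The energy form in terms of the derivatives of its arguments. -/
def form (h : IsCoeff ν L a d) : L2Ω →L[ℝ] L2Ω →L[ℝ] ℝ :=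
  (innerSL ℝ).comp (mulL h.memLp + primL.adjoint.comp ((mulL h.bdd).comp primL))

theorem form_apply (h : IsCoeff ν L a d) (g k : L2Ω) :
    h.form g k = inner ℝ (mulL h.memLp g) k + inner ℝ (mulL h.bdd (primL g)) (primL k) := by
  simp only [form, ContinuousLinearMap.comp_apply, add_apply,
    innerSL_apply_apply, inner_add_left, ContinuousLinearMap.adjoint_inner_left]

theorem form_eq_integral (h : IsCoeff ν L a d) (g k : L2Ω) :
    h.form g k = (∫ x, a x * g x * k x ∂volΩ) + ∫ x, d x * primL g x * primL k x ∂volΩ := by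
  rw [form_apply, inner_L2Ω, inner_L2Ω]
  congr 1
  · apply integral_congr_ae
    filter_upwards [coeFn_mulL h.memLp g] with x hx
    rw [hx]
  · apply integral_congr_ae
    filter_upwards [coeFn_mulL h.bdd (primL g)] with x hx
    rw [hx]

theorem form_symm (h : IsCoeff ν L a d) (g k : L2Ω) : h.form g k = h.form k g := by
  rw [form_eq_integral, form_eq_integral]
  congr 2 <;> funext x <;> ring

theorem form_coercive (h : IsCoeff ν L a d) (g : L2Ω) : ν * ‖g‖ ^ 2 ≤ h.form g g := by
  have h1 : 0 ≤ ∫ x, d x * primL g x * primL g x ∂volΩ := by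
    refine integral_nonneg_of_ae ?_
    filter_upwards [h.nonneg] with x hx
    rw [mul_assoc]
    exact mul_nonneg hx (mul_self_nonneg _)
  have h2 : ν * ‖g‖ ^ 2 ≤ ∫ x, a x * g x * g x ∂volΩ := by
    rw [norm_sq_L2Ω, ← integral_const_mul]
    refine integral_mono_ae ((Lp.memLp g).integrable_sq.const_mul ν) ?_ ?_
    · have := (Lp.memLp (mulL h.memLp g)).integrable_mul (Lp.memLp g)
      refine this.congr ?_
      filter_upwards [coeFn_mulL h.memLp g] with x hx
      rw [Pi.mul_apply, hx]
    · filter_upwards [ae_volΩ_mem] with x hx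
      rw [sq, mul_assoc]
      exact mul_le_mul_of_nonneg_right (h.le x (Ioo_subset_Icc_self hx)) (mul_self_nonneg _)
  rw [form_eq_integral]
  linarith

theorem energyForm_eq (h : IsCoeff ν L a d) {v w : ℝ → ℝ} (hv : MemH10 v) (hw : MemH10 w) :
    energyForm a d v w = h.form hv.grad hw.grad := by
  rw [form_eq_integral, energyForm]
  congr 1
  · apply integral_congr_ae
    filter_upwards [hv.coeFn_grad, hw.coeFn_grad] with x h1 h2
    rw [h1, h2]
  · apply integral_congr_ae
    filter_upwards [hv.ae_eq_prim, hw.ae_eq_prim, coeFn_primL hv.grad,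
      coeFn_primL hw.grad] with x h1 h2 h3 h4
    rw [h1, h2, h3, h4]

/-- The derivative `g` of a Galerkin solution with right-hand side `f`, for the space of the
functions with derivative in `M`. -/
def IsSol (h : IsCoeff ν L a d) (M : Submodule ℝ L2Ω) (f g : L2Ω) : Prop :=
  g ∈ M ∧ ∀ k ∈ M, h.form g k = inner ℝ f (primL k)

variable {h : IsCoeff ν L a d} {M : Submodule ℝ L2Ω}

theorem exists_isSol (h : IsCoeff ν L a d) (M : Submodule ℝ L2Ω) [CompleteSpace M] (f : L2Ω) :
    ∃ g, h.IsSol M f g :=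
  exists_galerkin h.pos h.form_coercive M ((innerSL ℝ f).comp primL)

theorem IsSol.add_smul {f g f' g' : L2Ω} (h1 : h.IsSol M f g) (h2 : h.IsSol M f' g') (s t : ℝ) :
    h.IsSol M (s • f + t • f') (s • g + t • g') := by
  refine ⟨M.add_mem (M.smul_mem s h1.1) (M.smul_mem t h2.1), fun k hk => ?_⟩
  simp only [map_add, map_smul, add_apply, smul_apply,
    h1.2 k hk, h2.2 k hk, inner_add_left, real_inner_smul_left, smul_eq_mul]

theorem IsSol.norm_le {f g : L2Ω} (h1 : h.IsSol M f g) : ‖g‖ ≤ ‖f‖ / ν := by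
  have h2 := h.form_coercive g
  rw [h1.2 g h1.1] at h2
  have h3 := real_inner_le_norm f (primL g)
  have h4 := mul_le_mul_of_nonneg_left (norm_primL_le g) (norm_nonneg f)
  rw [le_div_iff₀ h.pos]
  rcases (norm_nonneg g).eq_or_lt with h0 | h0
  · rw [← h0, zero_mul]; exact norm_nonneg f
  · nlinarith

/-- Self-adjointness of the solution operator, inherited from the symmetry of the form. -/
theorem IsSol.inner_comm {f g f' g' : L2Ω} (h1 : h.IsSol M f g) (h2 : h.IsSol M f' g') :
    inner ℝ f' (primL g) = inner ℝ f (primL g') := by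
  rw [← h1.2 _ h2.1, ← h2.2 _ h1.1, h.form_symm]

end IsCoeff

/-! ### The flux equation and regularity of solutions. -/

/-- Integration by parts without boundary terms, as the primitive of a mean-zero k vanishes at both
ends; shown by approximating k with derivatives of test functions. -/
theorem inner_primL_comm_of_mem (r : L2Ω) {k : L2Ω} (hk : k ∈ meanZero) :
    inner ℝ r (primL k) = - inner ℝ (primL r) k := by
  rw [← sub_eq_zero, sub_neg_eq_add]
  refine eq_of_forall_norm_sub_le (‖r‖ + ‖primL r‖) fun ε hε => ?_
  obtain ⟨φ, hφ, h1⟩ := exists_test_norm_sub_deriv_lt hk hε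
  set k' := (hφ.memLp_deriv 2).toLp _ with hk'
  have h2 : inner ℝ r (primL k') + inner ℝ (primL r) k' = 0 := by
    have h3 := integral_prim_mul_deriv r hφ
    have h4 : inner ℝ (primL r) k' = ∫ x, prim r x * deriv φ x ∂volΩ := by
      rw [hk', inner_toLp_right]
      apply integral_congr_ae
      filter_upwards [coeFn_primL r] with x hx
      rw [hx]
    rw [← hφ.toLp_eq_primL, inner_toLp_right, h4, h3, add_neg_cancel]
  have h3 : inner ℝ r (primL k) + inner ℝ (primL r) k =
      inner ℝ r (primL (k - k')) + inner ℝ (primL r) (k - k') := by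
    rw [map_sub, inner_sub_right, inner_sub_right]
    linarith
  rw [sub_zero, h3, add_mul]
  refine (norm_add_le _ _).trans (add_le_add ?_ ?_)
  · refine (norm_inner_le_norm _ _).trans (mul_le_mul_of_nonneg_left ?_ (norm_nonneg _))
    exact (norm_primL_le _).trans h1.le
  · exact (norm_inner_le_norm _ _).trans (mul_le_mul_of_nonneg_left h1.le (norm_nonneg _))

theorem inner_oneL_oneL : inner ℝ oneL oneL = 1 := by
  rw [inner_oneL, integral_congr_ae coeFn_oneL]
  simp

/-- Subtracting its mean from w leaves a mean-zero function orthogonal to itself. -/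
theorem exists_eq_smul_oneL {w : L2Ω} (hw : ∀ k ∈ meanZero, inner ℝ w k = 0) :
    w = (inner ℝ oneL w : ℝ) • oneL := by
  have h1 : w - (inner ℝ oneL w : ℝ) • oneL ∈ meanZero := by
    rw [mem_meanZero, ← inner_oneL, inner_sub_right, real_inner_smul_right, inner_oneL_oneL]
    ring
  have h2 := hw _ h1
  have h3 : inner ℝ oneL (w - (inner ℝ oneL w : ℝ) • oneL) = 0 := by
    rw [inner_oneL]; exact mem_meanZero.1 h1
  rw [← sub_eq_zero, ← norm_eq_zero, ← sq_eq_zero_iff, ← real_inner_self_eq_norm_sq,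
    inner_sub_left, h2, real_inner_smul_left, h3]
  ring

theorem abs_prim_sub_le {g : ℝ → ℝ} (hg : Integrable g volΩ) {C : ℝ}
    (hC : ∀ᵐ x ∂volΩ, |g x| ≤ C) {x y : ℝ} (hx : x ∈ Icc (0 : ℝ) 1) (hy : y ∈ Icc (0 : ℝ) 1) :
    |prim g x - prim g y| ≤ C * |x - y| := by
  wlog hxy : y ≤ x generalizing x y
  · rw [abs_sub_comm, abs_sub_comm x]
    exact this hy hx (not_le.1 hxy).le
  rw [prim_sub_prim' hg hy.1 hxy hx.2, abs_of_nonneg (sub_nonneg.2 hxy),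
    ← Real.volume_real_Ioo_of_le hxy]
  have h1 := (ae_restrict_iff' measurableSet_Ioo).1 hC
  rw [← Real.norm_eq_abs]
  refine norm_setIntegral_le_of_norm_le_const_ae' (measure_Ioo_lt_top (μ := volume)) ?_
  filter_upwards [h1] with t ht ht'
  exact ht (Ioo_subset_Ioo hy.1 hx.2 ht')

theorem nonneg_of_ae_abs_le {f : ℝ → ℝ} {F : ℝ} (hF : ∀ᵐ x ∂volΩ, |f x| ≤ F) : 0 ≤ F := by
  obtain ⟨x, hx⟩ := hF.exists
  exact (abs_nonneg _).trans hx

theorem exists_ae_abs_le {f : ℝ → ℝ} (hf : MemLp f ⊤ volΩ) :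
    ∃ F : ℝ, 0 ≤ F ∧ ∀ᵐ x ∂volΩ, |f x| ≤ F := by
  refine ⟨(eLpNorm f ⊤ volΩ).toReal, ENNReal.toReal_nonneg, ?_⟩
  have h1 := ae_le_eLpNormEssSup (f := f) (μ := volΩ)
  filter_upwards [h1] with x hx
  rw [← eLpNorm_exponent_top, ← ENNReal.ofReal_toReal hf.2.ne, ← ofReal_norm,
    ENNReal.ofReal_le_ofReal_iff ENNReal.toReal_nonneg] at hx
  exact hx

namespace IsCoeff

variable {ν : ℝ} {L : ℝ≥0} {a d : ℝ → ℝ}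

/-- The equation `(a u')' = d u - f` in integrated form. -/
theorem IsSol.exists_flux_eq {h : IsCoeff ν L a d} {f g : L2Ω} (hs : h.IsSol meanZero f g) :
    ∃ c : ℝ, |c| ≤ ‖mulL h.memLp g‖ + ‖f - mulL h.bdd (primL g)‖ ∧
      ∀ᵐ x ∂volΩ, a x * g x = c - prim (f - mulL h.bdd (primL g) : L2Ω) x := by
  set r := f - mulL h.bdd (primL g) with hr
  -- After integration by parts the weak equation says that a g + prim r is orthogonal to all
  -- mean-zero functions, hence constant.
  have hw : ∀ k ∈ meanZero, inner ℝ (mulL h.memLp g + primL r) k = 0 := by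
    intro k hk
    have h1 := hs.2 k hk
    rw [form_apply] at h1
    have h2 : inner ℝ r (primL k) = inner ℝ (mulL h.memLp g) k := by
      rw [hr, inner_sub_left]; linarith
    rw [inner_primL_comm_of_mem r hk] at h2
    rw [inner_add_left]
    linarith
  have h1 := exists_eq_smul_oneL hw
  set c : ℝ := inner ℝ oneL (mulL h.memLp g + primL r) with hc
  refine ⟨c, ?_, ?_⟩
  · calc |c| ≤ ‖oneL‖ * ‖mulL h.memLp g + primL r‖ := abs_real_inner_le_norm _ _
      _ ≤ 1 * (‖mulL h.memLp g‖ + ‖r‖) := by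
        gcongr
        · exact norm_oneL_le
        · exact (norm_add_le _ _).trans (add_le_add le_rfl (norm_primL_le r))
      _ = _ := one_mul _
  · have h2 := Lp.coeFn_add (mulL h.memLp g) (primL r)
    rw [h1] at h2
    filter_upwards [h2, Lp.coeFn_smul c oneL, coeFn_oneL, coeFn_mulL h.memLp g,
      coeFn_primL r] with x e1 e2 e3 e4 e5
    rw [e2, Pi.smul_apply, e3, Pi.add_apply, e4, e5, smul_eq_mul] at e1
    linarith

/-- For bounded right-hand sides, the derivative of the solution is bounded and Lipschitz. -/
theorem exists_regularity (h : IsCoeff ν L a d) : ∃ C : ℝ, 0 ≤ C ∧ ∀ (f g : L2Ω) (F : ℝ),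
    h.IsSol meanZero f g → (∀ᵐ x ∂volΩ, |f x| ≤ F) → (∀ᵐ x ∂volΩ, |g x| ≤ C * F) ∧
      ∃ gc : ℝ → ℝ, g =ᵐ[volΩ] gc ∧
        ∀ x ∈ Ioo (0 : ℝ) 1, ∀ y ∈ Ioo (0 : ℝ) 1, |gc x - gc y| ≤ C * F * |x - y| := by
  obtain ⟨D, hD0, hD⟩ := exists_ae_abs_le h.bdd
  have hν := h.pos
  set A := ‖mulL h.memLp‖ with hA
  have hA0 : 0 ≤ A := norm_nonneg _
  set c₁ := 1 + D / ν with hc₁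
  have hc₁0 : 0 ≤ c₁ := by positivity
  set c₂ := A / ν + 2 * c₁ with hc₂
  have hc₂0 : 0 ≤ c₂ := by positivity
  -- Sum of the constant c₂/ν of the sup bound and the Lipschitz constant of the quotient (c − prim
  -- r)/a; c₁ F bounds r, and c₂ F bounds the flux.
  refine ⟨c₂ / ν + (c₁ / ν + c₂ * L / ν ^ 2), by positivity, fun f g F hs hF => ?_⟩
  have hF0 := nonneg_of_ae_abs_le hF
  have hgn : ‖g‖ ≤ F / ν := hs.norm_le.trans (by gcongr; exact norm_le_of_ae_abs_le hF0 hF)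
  obtain ⟨c, hc, hflux⟩ := hs.exists_flux_eq
  set r := f - mulL h.bdd (primL g) with hr
  have hrF : ∀ᵐ x ∂volΩ, |r x| ≤ c₁ * F := by
    filter_upwards [Lp.coeFn_sub f (mulL h.bdd (primL g)), coeFn_mulL h.bdd (primL g),
      coeFn_primL g, hF, hD] with x e1 e2 e3 e4 e5
    rw [e1, Pi.sub_apply, e2, e3]
    refine (abs_sub _ _).trans ?_
    rw [abs_mul]
    have := mul_le_mul e5 ((abs_prim_le g x).trans hgn) (abs_nonneg _) hD0
    have e6 : c₁ * F = F + D * (F / ν) := by rw [hc₁]; ring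
    linarith
  have hrn : ‖r‖ ≤ c₁ * F := norm_le_of_ae_abs_le (by positivity) hrF
  have hN : ∀ x, |c - prim r x| ≤ c₂ * F := fun x => by
    refine (abs_sub _ _).trans ?_
    have e1 := abs_prim_le r x
    have e2 : ‖mulL h.memLp g‖ ≤ A * (F / ν) :=
      ((mulL h.memLp).le_opNorm g).trans (by gcongr)
    have e3 : c₂ * F = A * (F / ν) + 2 * (c₁ * F) := by rw [hc₂]; ring
    linarith
  have hg : g =ᵐ[volΩ] fun x => (c - prim r x) / a x := by
    filter_upwards [hflux, ae_volΩ_mem] with x hx hx'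
    have : a x ≠ 0 := (hν.trans_le (h.le x (Ioo_subset_Icc_self hx'))).ne'
    rw [← hx]; field_simp
  have hbd : ∀ x ∈ Ioo (0 : ℝ) 1, |(c - prim r x) / a x| ≤ c₂ / ν * F := fun x hx => by
    have h1 := h.le x (Ioo_subset_Icc_self hx)
    have h0 : 0 < a x := hν.trans_le h1
    rw [abs_div, abs_of_pos h0, div_mul_eq_mul_div]
    exact div_le_div₀ (by positivity) (hN x) hν h1
  refine ⟨?_, _, hg, fun x hx y hy => ?_⟩
  · filter_upwards [hg, ae_volΩ_mem] with x e1 hx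
    rw [e1]
    refine (hbd x hx).trans ?_
    gcongr
    exact le_add_of_nonneg_right (by positivity)
  · have hx' := Ioo_subset_Icc_self hx
    have hy' := Ioo_subset_Icc_self hy
    have hax := h.le x hx'
    have hax0 : 0 < a x := hν.trans_le hax
    have hay0 : 0 < a y := hν.trans_le (h.le y hy')
    have h1 := abs_prim_sub_le (integrable_L2Ω r) hrF hx' hy'
    have h2 : |a x - a y| ≤ L * |x - y| := h.lip.dist_le_mul x hx' y hy'
    have e : (c - prim r x) / a x - (c - prim r y) / a y =
        -(prim r x - prim r y) / a x - (c - prim r y) / a y * (a x - a y) / a x := by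
      field_simp
      ring
    rw [e]
    refine (abs_sub _ _).trans ?_
    rw [abs_div, abs_div, abs_neg, abs_of_pos hax0, abs_mul]
    have h3 : |prim r x - prim r y| / a x ≤ c₁ * F * |x - y| / ν :=
      div_le_div₀ (by positivity) h1 hν hax
    have h4 : |(c - prim r y) / a y| * |a x - a y| / a x ≤
        c₂ / ν * F * (L * |x - y|) / ν :=
      div_le_div₀ (by positivity)
        (mul_le_mul (hbd y hy) h2 (abs_nonneg _) (by positivity)) hν hax
    have h5 : 0 ≤ c₂ / ν * F * |x - y| := by positivity
    calc _ ≤ c₁ * F * |x - y| / ν + c₂ / ν * F * (L * |x - y|) / ν := add_le_add h3 h4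
      _ ≤ c₁ * F * |x - y| / ν + c₂ / ν * F * (L * |x - y|) / ν + c₂ / ν * F * |x - y| := by
        linarith
      _ = _ := by ring

/-! ### Error estimates of order h² for states. -/

/-- The cellwise averages of g serve as approximation: they keep the mean value zero, so they lie in
`gradSpace`. -/
theorem exists_approx {g : L2Ω} (hg : g ∈ meanZero) {gc : ℝ → ℝ} (hgc : g =ᵐ[volΩ] gc) {D : ℝ}
    (hD : 0 ≤ D)
    (hlip : ∀ x ∈ Ioo (0 : ℝ) 1, ∀ y ∈ Ioo (0 : ℝ) 1, |gc x - gc y| ≤ D * |x - y|) (T : Mesh) :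
    ∃ k ∈ T.gradSpace, ‖g - k‖ ≤ D * T.width := by
  have hgi : Integrable gc volΩ := (integrable_L2Ω g).congr hgc
  have hL := T.memLp_stepFun (T.avg gc) 2
  refine ⟨hL.toLp _, T.mem_gradSpace.2 ⟨?_, _, hL.coeFn_toLp⟩, ?_⟩
  · rw [mem_meanZero, integral_congr_ae hL.coeFn_toLp]
    refine (T.integral_proj hgi).trans ?_
    rw [← integral_congr_ae hgc]
    exact mem_meanZero.1 hg
  · refine norm_le_of_ae_abs_le (mul_nonneg hD T.width_pos.le) ?_
    filter_upwards [Lp.coeFn_sub g (hL.toLp _), hL.coeFn_toLp, hgc, T.ae_mem_cell]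
      with x e1 e2 e3 ⟨i, hi⟩
    rw [e1, Pi.sub_apply, e2, e3, abs_sub_comm]
    exact T.abs_proj_sub_le hgi hD hlip hi

/-- The weak error estimate of order `h²` for the discretization of the state equation. -/
theorem exists_galerkin_error (h : IsCoeff ν L a d) : ∃ C : ℝ, 0 ≤ C ∧
    ∀ (T : Mesh) (f f' g gh : L2Ω) (F F' : ℝ), h.IsSol meanZero f g → h.IsSol T.gradSpace f gh →
      (∀ᵐ x ∂volΩ, |f x| ≤ F) → (∀ᵐ x ∂volΩ, |f' x| ≤ F') →
      |inner ℝ f' (primL (g - gh))| ≤ C * F * F' * T.width ^ 2 := by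
  obtain ⟨C, hC, hreg⟩ := h.exists_regularity
  have hν := h.pos
  refine ⟨‖h.form‖ ^ 2 / ν * C ^ 2, by positivity, fun T f f' g gh F F' hg hgh hF hF' => ?_⟩
  obtain ⟨g', hg'⟩ := h.exists_isSol meanZero f'
  obtain ⟨-, gc, hgc, hlip⟩ := hreg f g F hg hF
  obtain ⟨-, gc', hgc', hlip'⟩ := hreg f' g' F' hg' hF'
  obtain ⟨k, hk, hk1⟩ := exists_approx hg.1 hgc
    (mul_nonneg hC (nonneg_of_ae_abs_le hF)) hlip T
  obtain ⟨k', hk', hk1'⟩ := exists_approx hg'.1 hgc'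
    (mul_nonneg hC (nonneg_of_ae_abs_le hF')) hlip' T
  have := galerkin_pairing_le (B := h.form) (ℓ := (innerSL ℝ f).comp primL)
    (ℓ' := (innerSL ℝ f').comp primL) hν h.form_coercive h.form_symm T.gradSpace_le
    hg.1 hg.2 hgh.1 hgh.2 hg'.2 hk hk' hk1 hk1'
  refine this.trans (le_of_eq ?_)
  ring

/-- Replacing the control by its projection changes the state, tested with a bounded function, in
the order `h²`. -/
theorem exists_proj_error (h : IsCoeff ν L a d) : ∃ C : ℝ, 0 ≤ C ∧
    ∀ (T : Mesh) (q : ℝ → ℝ) (f' f s : L2Ω) (F' : ℝ), MemBV q → (∀ᵐ x ∂volΩ, |f' x| ≤ F') →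
      (f =ᵐ[volΩ] fun x => T.proj q x - q x) → h.IsSol meanZero f s →
      |inner ℝ f' (primL s)| ≤ C * F' * T.width ^ 2 * totalVar q := by
  obtain ⟨C, hC, hreg⟩ := h.exists_regularity
  refine ⟨C, hC, fun T q f' f s F' hq hF' hf hs => ?_⟩
  obtain ⟨g', hg'⟩ := h.exists_isSol meanZero f'
  have hb := (hreg f' g' F' hg' hF').1
  have hgi := integrable_L2Ω g'
  have hpi := memLp_prim hgi 2
  have h1 := T.abs_integral_mul_proj_sub_le hq hpi
    (mul_nonneg hC (nonneg_of_ae_abs_le hF')) fun x hx y hy =>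
      abs_prim_sub_le hgi hb (Ioo_subset_Icc_self hx) (Ioo_subset_Icc_self hy)
  -- Self-adjointness moves the solution operator onto f'; that of the projection then turns the
  -- pairing into ∫ q (Pp − p) with p = `prim g'`.
  rw [hs.inner_comm hg', inner_primL_right]
  refine le_trans (le_of_eq ?_) h1
  congr 1
  have hpj := T.memLp_stepFun (T.avg (prim g')) ⊤
  have e1 : ∫ x, f x * prim g' x ∂volΩ =
      ∫ x, T.proj q x * prim g' x - q x * prim g' x ∂volΩ := by
    apply integral_congr_ae
    filter_upwards [hf] with x hx
    rw [hx, sub_mul]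
  have i1 : Integrable (fun x => T.proj q x * prim g' x) volΩ :=
    (T.integrable_proj q).mul_of_top_left (memLp_prim hgi ⊤)
  have i2 : Integrable (fun x => q x * prim g' x) volΩ :=
    hq.1.mul_of_top_left (memLp_prim hgi ⊤)
  have i3 : Integrable (fun x => q x * T.proj (prim g') x) volΩ := hq.1.mul_of_top_left hpj
  rw [e1, integral_sub i1 i2, T.integral_mul_proj hq.1 (integrable_of_memLp_two hpi),
    ← integral_sub i3 i2]
  congr 1
  funext x
  ring

end IsCoeff

theorem Mesh.ae_abs_proj_le (T : Mesh) {q : ℝ → ℝ} {Q : ℝ} (hQ : ∀ᵐ x ∂volΩ, |q x| ≤ Q) :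
    ∀ᵐ x ∂volΩ, |T.proj q x| ≤ Q := by
  filter_upwards [T.ae_mem_cell] with x ⟨i, hi⟩
  have hlen := T.len_pos i
  have h1 := norm_setIntegral_le_of_norm_le_const_ae (μ := volume) (s := T.cell i) (f := q)
    (by simp [Mesh.cell]) (T.ae_restrict_cell hQ i)
  rw [T.volume_real_cell, Real.norm_eq_abs] at h1
  rw [Mesh.proj, T.stepFun_of_mem _ hi, Mesh.avg, abs_mul, abs_of_pos (inv_pos.2 hlen),
    inv_mul_le_iff₀ hlen, mul_comm]
  exact h1

/-! ### Minimizers: optimality, control bounds and the error estimate. -/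

namespace IsCoeff

variable {ν : ℝ} {L : ℝ≥0} {a d : ℝ → ℝ}

/-- The control `q`, as the element `f` of `L²(Ω)`, and the derivative `g` of its state minimize the
objective, where the controls range over `𝒬` and the derivatives of the states over `M`. -/
structure IsMin (h : IsCoeff ν L a d) (M : Submodule ℝ L2Ω) (𝒬 : Set (ℝ → ℝ)) (α : ℝ) (ud : L2Ω)
    (q : ℝ → ℝ) (f g : L2Ω) : Prop where
  mem : q ∈ 𝒬
  memBV : MemBV q
  ae_eq : f =ᵐ[volΩ] q
  isSol : h.IsSol M f g
  le : ∀ (p : ℝ → ℝ) (f' s : L2Ω), p ∈ 𝒬 → MemBV p → f' =ᵐ[volΩ] p → h.IsSol M f' s →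
    1 / 2 * ‖primL g - ud‖ ^ 2 + α * totalVar q ≤ 1 / 2 * ‖primL s - ud‖ ^ 2 + α * totalVar p

variable {h : IsCoeff ν L a d} {M : Submodule ℝ L2Ω} {𝒬 : Set (ℝ → ℝ)} {α : ℝ} {ud : L2Ω}
  {q : ℝ → ℝ} {f g : L2Ω}

/-- Comparison with the zero control and its zero state. -/
theorem IsMin.bound (hm : h.IsMin M 𝒬 α ud q f g) (hα : 0 < α) (h0 : (fun _ => 0) ∈ 𝒬) :
    ‖primL g - ud‖ ≤ ‖ud‖ ∧ totalVar q ≤ ‖ud‖ ^ 2 / (2 * α) := by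
  have hz := memBV_of_forall (q := fun _ => (0 : ℝ)) (C := 0) le_rfl (integrable_zero _ _ _)
    fun φ _ _ => by simp
  have h1 := hm.le _ 0 0 h0 hz.1 (Lp.coeFn_zero _ _ _) ⟨M.zero_mem, fun k _ => by simp⟩
  rw [le_antisymm hz.2 (totalVar_nonneg _), map_zero, zero_sub, norm_neg, mul_zero, add_zero] at h1
  have h2 := mul_nonneg hα.le (totalVar_nonneg q)
  constructor
  · refine abs_le_of_sq_le_sq' ?_ (norm_nonneg _) |>.2
    linarith
  · rw [le_div_iff₀ (by positivity)]
    have := sq_nonneg ‖primL g - ud‖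
    linarith

/-- Compare with the control (1 − t) q + t p, use convexity of the total variation, divide by t and
let t tend to 0. The total variation is never differentiated. -/
theorem IsMin.variational_ineq (hm : h.IsMin M 𝒬 α ud q f g) (hα : 0 < α)
    (hconv : ∀ p ∈ 𝒬, ∀ s t : ℝ, (fun x => s * q x + t * p x) ∈ 𝒬) {p : ℝ → ℝ} {f' s : L2Ω}
    (hp : p ∈ 𝒬) (hpBV : MemBV p) (hf' : f' =ᵐ[volΩ] p) (hs : h.IsSol M f' s) :
    0 ≤ inner ℝ (primL g - ud) (primL (s - g)) + α * (totalVar p - totalVar q) := by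
  set I : ℝ := inner ℝ (primL g - ud) (primL (s - g)) with hI
  set N : ℝ := ‖primL (s - g)‖ ^ 2 with hN
  have key : ∀ t : ℝ, 0 < t → t ≤ 1 →
      0 ≤ I + α * (totalVar p - totalVar q) + t * (N / 2) := by
    intro t ht ht1
    have hBV := hm.memBV.add_smul hpBV (sub_nonneg.2 ht1) ht.le
    have h1 := hm.le _ ((1 - t) • f + t • f') ((1 - t) • g + t • s) (hconv p hp (1 - t) t) hBV.1
      ?_ (hm.isSol.add_smul hs _ _)
    · have e1 : primL ((1 - t) • g + t • s) - ud = (primL g - ud) + t • primL (s - g) := by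
        simp only [map_add, map_smul, map_sub, sub_smul, one_smul, smul_sub]
        abel
      rw [e1, norm_add_sq_real, real_inner_smul_right, norm_smul, Real.norm_eq_abs, mul_pow,
        sq_abs, ← hI, ← hN] at h1
      have h2 := mul_le_mul_of_nonneg_left hBV.2 hα.le
      have h3 : 0 ≤ t * (I + α * (totalVar p - totalVar q) + t * (N / 2)) := by
        nlinarith
      exact nonneg_of_mul_nonneg_right h3 ht
    · filter_upwards [Lp.coeFn_add ((1 - t) • f) (t • f'), Lp.coeFn_smul (1 - t) f,
        Lp.coeFn_smul t f', hm.ae_eq, hf'] with x e1 e2 e3 e4 e5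
      rw [e1, Pi.add_apply, e2, e3, Pi.smul_apply, Pi.smul_apply, e4, e5, smul_eq_mul, smul_eq_mul]
  have hlim : Tendsto (fun t : ℝ => I + α * (totalVar p - totalVar q) + t * (N / 2)) (𝓝[>] 0)
      (𝓝 (I + α * (totalVar p - totalVar q) + 0 * (N / 2))) :=
    ((continuous_const.add (continuous_id.mul continuous_const)).tendsto _).mono_left
      nhdsWithin_le_nhds
  rw [zero_mul, add_zero] at hlim
  refine ge_of_tendsto hlim ?_
  filter_upwards [Ioc_mem_nhdsGT (zero_lt_one (α := ℝ))] with t ht using key t ht.1 ht.2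

/-- A bound for the control in terms of its total variation and of its state. -/
theorem IsSol.ae_abs_le_of_totalVar_le {U V κ : ℝ} {s₁ : L2Ω} (hg : h.IsSol M f g)
    (hs₁ : h.IsSol M oneL s₁) (hκ : 0 < κ) (hκs : κ ≤ inner ℝ oneL (primL s₁)) (hq : MemBV q)
    (hf : f =ᵐ[volΩ] q) (hV : totalVar q ≤ V) (hU : ‖primL g‖ ≤ U) :
    ∀ᵐ x ∂volΩ, |q x| ≤ 2 * V + (U + 2 * V / ν) / κ := by
  obtain ⟨c, hc⟩ := hq.exists_ae_abs_sub_le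
  have hν := h.pos
  have hρ : ∀ᵐ x ∂volΩ, |((1 : ℝ) • f + (-c) • oneL : L2Ω) x| ≤ 2 * V := by
    filter_upwards [Lp.coeFn_add ((1 : ℝ) • f) ((-c) • oneL), Lp.coeFn_smul (1 : ℝ) f,
      Lp.coeFn_smul (-c) oneL, coeFn_oneL, hf, hc] with x e1 e2 e3 e4 e5 e6
    rw [e1, Pi.add_apply, e2, e3, Pi.smul_apply, Pi.smul_apply, e4, e5, smul_eq_mul, smul_eq_mul,
      one_mul, mul_one, ← sub_eq_add_neg]
    linarith
  have hV0 := nonneg_of_ae_abs_le hρ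
  have hsol := (hg.add_smul hs₁ 1 (-c)).norm_le
  have h1 : ‖(1 : ℝ) • g + (-c) • s₁‖ ≤ 2 * V / ν :=
    hsol.trans (by gcongr; exact norm_le_of_ae_abs_le hV0 hρ)
  -- Write q = c + ρ with |ρ| ≤ 2V. The state of the constant c is the state of q minus that of ρ,
  -- both bounded, and pairing it with 1 isolates c.
  have h2 : c * inner ℝ oneL (primL s₁) =
      inner ℝ oneL (primL g - primL ((1 : ℝ) • g + (-c) • s₁)) := by
    rw [map_add, map_smul, map_smul, one_smul, sub_add_cancel_left, neg_smul, neg_neg,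
      real_inner_smul_right]
  have h3 : |c| * κ ≤ U + 2 * V / ν := by
    calc |c| * κ ≤ |c| * inner ℝ oneL (primL s₁) := by gcongr
      _ = |c * inner ℝ oneL (primL s₁)| := by rw [abs_mul, abs_of_nonneg (hκ.le.trans hκs)]
      _ ≤ ‖oneL‖ * ‖primL g - primL ((1 : ℝ) • g + (-c) • s₁)‖ := by
        rw [h2]; exact abs_real_inner_le_norm _ _
      _ ≤ 1 * (U + 2 * V / ν) := by
        gcongr
        · exact norm_oneL_le
        · exact (norm_sub_le _ _).trans (add_le_add hU ((norm_primL_le _).trans h1))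
      _ = _ := one_mul _
  rw [← le_div_iff₀ hκ] at h3
  filter_upwards [hc] with x hx
  have := abs_add_le (q x - c) c
  rw [sub_add_cancel] at this
  linarith

/-- Otherwise coercivity forces s₁ = 0, and testing the equation with a bump of integral 1 gives 1 =
0. -/
theorem inner_oneL_primL_pos {s₁ : L2Ω} (hs₁ : h.IsSol meanZero oneL s₁) :
    0 < inner ℝ oneL (primL s₁) := by
  by_contra! hle
  have h1 := h.form_coercive s₁
  rw [hs₁.2 _ hs₁.1] at h1
  have hν := h.pos
  have h2 : s₁ = 0 := by
    rw [← norm_eq_zero, ← sq_eq_zero_iff]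
    have := sq_nonneg ‖s₁‖
    nlinarith
  obtain ⟨ψ, hψ, -, hψ1⟩ := exists_test_integral_eq_one
  have h3 : (hψ.memLp_deriv 2).toLp _ ∈ meanZero := by
    rw [mem_meanZero, integral_congr_ae (hψ.memLp_deriv 2).coeFn_toLp, hψ.integral_deriv]
  have h4 := hs₁.2 _ h3
  rw [h2, map_zero, ← hψ.toLp_eq_primL, inner_oneL, integral_congr_ae (hψ.memLp 2).coeFn_toLp,
    hψ1] at h4
  simp at h4

/-- Uniform solvability on fine meshes: the discrete state for the control `1` stays away from
zero. -/
theorem exists_width_le (h : IsCoeff ν L a d) : ∃ κ h₀ : ℝ, 0 < κ ∧ 0 < h₀ ∧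
    (∃ s₁, h.IsSol meanZero oneL s₁ ∧ κ ≤ inner ℝ oneL (primL s₁)) ∧
    ∀ T : Mesh, T.width ≤ h₀ →
      ∃ s₁, h.IsSol T.gradSpace oneL s₁ ∧ κ ≤ inner ℝ oneL (primL s₁) := by
  obtain ⟨C, hC, herr⟩ := h.exists_galerkin_error
  obtain ⟨s, hs⟩ := h.exists_isSol meanZero oneL
  have hpos := inner_oneL_primL_pos hs
  set k : ℝ := inner ℝ oneL (primL s) with hk
  -- For h ≤ h₀ the Galerkin error satisfies C h² ≤ C h ≤ k/2, the first inequality using h ≤ 1;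
  -- half of k survives.
  refine ⟨k / 2, min 1 (k / (2 * (C + 1))), by positivity, by positivity,
    ⟨s, hs, by linarith⟩, fun T hT => ?_⟩
  obtain ⟨s₁, hs₁⟩ := h.exists_isSol T.gradSpace oneL
  refine ⟨s₁, hs₁, ?_⟩
  have h1 : ∀ᵐ x ∂volΩ, |oneL x| ≤ 1 := by
    filter_upwards [coeFn_oneL] with x hx
    rw [hx, abs_one]
  have h2 := herr T oneL oneL s s₁ 1 1 hs hs₁ h1 h1
  rw [mul_one, mul_one, map_sub, inner_sub_right, ← hk] at h2
  have h3 := T.width_pos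
  have h4 := hT.trans (min_le_left _ _)
  have h5 := hT.trans (min_le_right _ _)
  rw [le_div_iff₀ (by positivity)] at h5
  have h6 := (le_abs_self _).trans h2
  nlinarith

theorem IsSol.ae_abs_primL_sub_le {Q U : ℝ} (hg : h.IsSol M f g)
    (hQ : ∀ᵐ x ∂volΩ, |f x| ≤ Q) (hU : ∀ᵐ x ∂volΩ, |ud x| ≤ U) :
    ∀ᵐ x ∂volΩ, |(primL g - ud : L2Ω) x| ≤ Q / ν + U := by
  have hν := h.pos
  have hn : ‖g‖ ≤ Q / ν :=
    hg.norm_le.trans (by gcongr; exact norm_le_of_ae_abs_le (nonneg_of_ae_abs_le hQ) hQ)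
  filter_upwards [Lp.coeFn_sub (primL g) ud, coeFn_primL g, hU] with x e1 e2 e3
  rw [e1, Pi.sub_apply, e2]
  exact (abs_sub _ _).trans (add_le_add ((abs_prim_le g x).trans hn) e3)

/-- The error estimate for the states of minimizers. -/
theorem exists_error_estimate (h : IsCoeff ν L a d) {α U : ℝ} (hα : 0 < α)
    (hU : ∀ᵐ x ∂volΩ, |ud x| ≤ U) : ∃ C : ℝ, 0 < C ∧
      ∀ (T : Mesh) (q qh : ℝ → ℝ) (f g fh gh : L2Ω), h.IsMin meanZero univ α ud q f g →
        h.IsMin T.gradSpace {p | ∃ c, p =ᵐ[volΩ] T.stepFun c} α ud qh fh gh →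
        ‖primL gh - primL g‖ ≤ C * T.width := by
  obtain ⟨κ, h₀, hκ, hh₀, ⟨s₁, hs₁, hκs₁⟩, hfine⟩ := h.exists_width_le
  obtain ⟨C₁, hC₁, herr⟩ := h.exists_galerkin_error
  obtain ⟨C₂, hC₂, hproj⟩ := h.exists_proj_error
  have hν := h.pos
  have hU0 := nonneg_of_ae_abs_le hU
  set V := ‖ud‖ ^ 2 / (2 * α) with hV
  have hV0 : 0 ≤ V := by positivity
  set Q := 2 * V + (2 * ‖ud‖ + 2 * V / ν) / κ with hQ
  have hQ0 : 0 ≤ Q := by positivity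
  set W := Q / ν + U with hW
  have hW0 : 0 ≤ W := by positivity
  -- Q bounds the controls, W the residuals u − u_d and u_h − u_d. The sum collects two Galerkin
  -- errors and one projection error.
  set A := 2 * (C₁ * Q * W) + C₂ * W * V with hA
  have hA0 : 0 ≤ A := by positivity
  -- √A serves the fine meshes, 2‖u_d‖/h₀ the coarse ones, where both states lie within ‖u_d‖ of
  -- u_d; the 1 ensures positivity.
  refine ⟨√A + 2 * ‖ud‖ / h₀ + 1, by positivity, fun T q qh f g fh gh hm hmh => ?_⟩
  have hw := T.width_pos
  have hb := hm.bound hα (mem_univ _)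
  have hstep0 : T.stepFun 0 = fun _ => 0 := by
    funext x
    simp [Mesh.stepFun]
  have hbh := hmh.bound hα ⟨0, by rw [hstep0]⟩
  rcases lt_or_ge h₀ T.width with hlarge | hsmall
  · have h1 : ‖primL gh - primL g‖ ≤ 2 * ‖ud‖ := by
      have := norm_sub_le (primL gh - ud) (primL g - ud)
      rw [sub_sub_sub_cancel_right] at this
      linarith [hb.1, hbh.1]
    have h2 : 2 * ‖ud‖ ≤ 2 * ‖ud‖ / h₀ * T.width := by
      rw [div_mul_eq_mul_div, le_div_iff₀ hh₀]
      gcongr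
    have h3 : 0 ≤ (√A + 1) * T.width := by positivity
    linarith
  · obtain ⟨s₁h, hs₁h, hκs₁h⟩ := hfine T hsmall
    have hU2 : ∀ {g : L2Ω}, ‖primL g - ud‖ ≤ ‖ud‖ → ‖primL g‖ ≤ 2 * ‖ud‖ := fun {g} hg => by
      have := norm_add_le (primL g - ud) ud
      rw [sub_add_cancel] at this
      linarith
    have hqQ := hm.isSol.ae_abs_le_of_totalVar_le hs₁ hκ hκs₁ hm.memBV hm.ae_eq hb.2 (hU2 hb.1)
    have hqhQ := hmh.isSol.ae_abs_le_of_totalVar_le hs₁h hκ hκs₁h hmh.memBV hmh.ae_eq hbh.2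
      (hU2 hbh.1)
    have hfQ : ∀ᵐ x ∂volΩ, |f x| ≤ Q := by
      filter_upwards [hm.ae_eq, hqQ] with x e1 e2
      rwa [e1]
    have hfhQ : ∀ᵐ x ∂volΩ, |fh x| ≤ Q := by
      filter_upwards [hmh.ae_eq, hqhQ] with x e1 e2
      rwa [e1]
    have hL := T.memLp_stepFun (T.avg q) 2
    set fp := hL.toLp _ with hfp
    have hfp' : fp =ᵐ[volΩ] T.proj q := hL.coeFn_toLp
    have hfpQ : ∀ᵐ x ∂volΩ, |fp x| ≤ Q := by
      filter_upwards [hfp', T.ae_abs_proj_le hqQ] with x e1 e2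
      rwa [e1]
    -- Derivatives of the auxiliary states S q_h, S Pq and S_h Pq.
    obtain ⟨r, hr⟩ := h.exists_isSol meanZero fh
    obtain ⟨s, hs⟩ := h.exists_isSol meanZero fp
    obtain ⟨sh, hsh⟩ := h.exists_isSol T.gradSpace fp
    have hBVp := T.memBV_proj hm.memBV
    have v1 := hm.variational_ineq hα (fun _ _ _ _ => mem_univ _) (mem_univ qh) hmh.memBV
      hmh.ae_eq hr
    have v2 := hmh.variational_ineq hα (p := T.proj q) ?_ ⟨_, .rfl⟩ hBVp.1 hfp' hsh
    · have w1 := hm.isSol.ae_abs_primL_sub_le hfQ hU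
      have w2 := hmh.isSol.ae_abs_primL_sub_le hfhQ hU
      have b1 := (le_abs_self _).trans (herr T fh _ r gh Q W hr hmh.isSol hfhQ w1)
      have b2 := (neg_le_abs _).trans (herr T fp _ s sh Q W hs hsh hfpQ w2)
      have hdiff : (1 : ℝ) • fp + (-1 : ℝ) • f =ᵐ[volΩ] fun x => T.proj q x - q x := by
        filter_upwards [Lp.coeFn_add ((1 : ℝ) • fp) ((-1 : ℝ) • f), Lp.coeFn_smul (1 : ℝ) fp,
          Lp.coeFn_smul (-1 : ℝ) f, hfp', hm.ae_eq] with x e1 e2 e3 e4 e5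
        rw [e1, Pi.add_apply, e2, e3, Pi.smul_apply, Pi.smul_apply, e4, e5, smul_eq_mul,
          smul_eq_mul]
        ring
      have b3 := (le_abs_self _).trans
        (hproj T q _ _ _ W hm.memBV w2 hdiff (hs.add_smul hm.isSol 1 (-1)))
      rw [one_smul, neg_smul, one_smul, ← sub_eq_add_neg] at b3
      have b4 : C₂ * W * T.width ^ 2 * totalVar q ≤ C₂ * W * T.width ^ 2 * V := by
        gcongr
        exact hb.2
      have b5 := mul_le_mul_of_nonneg_left hBVp.2 hα.le
      -- The variational inequalities replace the differences here by r − gh in the first product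
      -- and by sh − g = (sh − s) + (s − g) in the second, which are the three terms estimated
      -- above.
      have e : ‖primL gh - primL g‖ ^ 2 =
          inner ℝ (primL g - ud) (primL g - primL gh) -
            inner ℝ (primL gh - ud) (primL g - primL gh) := by
        rw [← inner_sub_left, sub_sub_sub_cancel_right, real_inner_self_eq_norm_sq, norm_sub_rev]
      simp only [map_sub, inner_sub_right] at v1 v2 b1 b2 b3 e
      have hfin : ‖primL gh - primL g‖ ^ 2 ≤ A * T.width ^ 2 := by
        rw [hA]
        linarith
      have h1 : ‖primL gh - primL g‖ ≤ √A * T.width := by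
        refine abs_le_of_sq_le_sq' ?_ (by positivity) |>.2
        rwa [mul_pow, Real.sq_sqrt hA0]
      have h3 : 0 ≤ (2 * ‖ud‖ / h₀ + 1) * T.width := by positivity
      linarith
    · rintro p ⟨c, hc⟩ σ t
      obtain ⟨c', hc'⟩ := hmh.mem
      refine ⟨fun i => σ * c' i + t * c i, ?_⟩
      filter_upwards [hc, hc', T.ae_mem_cell] with x e1 e2 ⟨i, hi⟩
      rw [e1, e2, T.stepFun_of_mem _ hi, T.stepFun_of_mem _ hi, T.stepFun_of_mem _ hi]

end IsCoeff

/-! ### Translation between the original problems and their formulation through derivatives. -/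

theorem MemH10.objective_eq {u : ℝ → ℝ} (hu : MemH10 u) (α : ℝ) {u_d : ℝ → ℝ}
    (hd : MemLp u_d 2 volΩ) (q : ℝ → ℝ) : objective α u_d u q =
      1 / 2 * ‖primL hu.grad - hd.toLp u_d‖ ^ 2 + α * totalVar q := by
  rw [objective, totalVar, norm_sq_L2Ω]
  congr 2
  apply integral_congr_ae
  filter_upwards [Lp.coeFn_sub (primL hu.grad) (hd.toLp u_d), coeFn_primL hu.grad,
    hd.coeFn_toLp, hu.ae_eq_prim] with x e1 e2 e3 e4
  rw [e1, Pi.sub_apply, e2, e3, e4]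

theorem integral_mul_eq_inner {q w : ℝ → ℝ} {F : L2Ω} (hF : F =ᵐ[volΩ] q) (hw : MemH10 w) :
    ∫ x, q x * w x ∂volΩ = inner ℝ F (primL hw.grad) := by
  rw [inner_primL_right]
  apply integral_congr_ae
  filter_upwards [hF, hw.ae_eq_prim] with x e1 e2
  rw [e1, e2]

namespace IsCoeff

variable {ν : ℝ} {L : ℝ≥0} {a d : ℝ → ℝ}

theorem isMin_of_isOptimal (h : IsCoeff ν L a d) {α : ℝ} {u_d u q : ℝ → ℝ}
    (hd : MemLp u_d 2 volΩ) (ho : IsOptimal α a d u_d u q) :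
    h.IsMin meanZero univ α (hd.toLp u_d) q ((ho.1.2.1.memLp 2).toLp q) ho.1.1.grad where
  mem := mem_univ _
  memBV := ho.1.2.1
  ae_eq := MemLp.coeFn_toLp _
  isSol := by
    refine ⟨ho.1.1.grad_mem, fun k hk => ?_⟩
    have hw := (memH10_of_ae_eq_prim hk (v := prim k) .rfl).1
    have h1 := ho.1.2.2 _ hw
    rwa [h.energyForm_eq ho.1.1 hw, integral_mul_eq_inner (MemLp.coeFn_toLp _) hw,
      hw.grad_eq hk .rfl] at h1
  le p f' s _ hp hf' hs := by
    have hv := (memH10_of_ae_eq_prim hs.1 (v := prim s) .rfl).1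
    have h1 := ho.2 (prim s) p ⟨hv, hp, fun w hw => by
      rw [h.energyForm_eq hv hw, integral_mul_eq_inner hf' hw, hv.grad_eq hs.1 .rfl,
        hs.2 _ hw.grad_mem]⟩
    rwa [ho.1.1.objective_eq α hd, hv.objective_eq α hd, hv.grad_eq hs.1 .rfl] at h1

theorem isMin_of_isOptimalCd (h : IsCoeff ν L a d) {T : Mesh} {α : ℝ} {u_d u q : ℝ → ℝ}
    (hd : MemLp u_d 2 volΩ) (ho : IsOptimalCd T α a d u_d u q) :
    h.IsMin T.gradSpace {p | ∃ c, p =ᵐ[volΩ] T.stepFun c} α (hd.toLp u_d) q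
      ((ho.1.2.1.1.memLp 2).toLp q) ho.1.1.1.grad where
  mem := T.exists_ae_eq_stepFun ho.1.2.1.2
  memBV := ho.1.2.1.1
  ae_eq := MemLp.coeFn_toLp _
  isSol := by
    refine ⟨ho.1.1.grad_mem, fun k hk => ?_⟩
    have hw := T.memVh_prim hk
    have h1 := ho.1.2.2 _ hw
    rwa [h.energyForm_eq ho.1.1.1 hw.1, integral_mul_eq_inner (MemLp.coeFn_toLp _) hw.1,
      hw.1.grad_eq (T.gradSpace_le hk) .rfl] at h1
  le p f' s hp' hp hf' hs := by
    have hv := T.memVh_prim hs.1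
    obtain ⟨c, hc⟩ := hp'
    have hp'' : MemQh T p := ⟨hp, fun i => ⟨c i, by
      filter_upwards [T.ae_restrict_cell hc i, ae_restrict_mem (T.measurableSet_cell i)]
        with x e1 e2
      rw [e1, T.stepFun_of_mem c e2]⟩⟩
    have h1 := ho.2 (prim s) p ⟨hv, hp'', fun w hw => by
      rw [h.energyForm_eq hv.1 hw.1, integral_mul_eq_inner hf' hw.1,
        hv.1.grad_eq (T.gradSpace_le hs.1) .rfl, hs.2 _ hw.grad_mem]⟩
    rwa [ho.1.1.1.objective_eq α hd, hv.1.objective_eq α hd,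
      hv.1.grad_eq (T.gradSpace_le hs.1) .rfl] at h1

end IsCoeff

end BVControl

end

theorem mainTheorem4 (α ν : ℝ) (hα : 0 < α) (hν : 0 < ν) (a d₀ u_d : ℝ → ℝ)
    (ha_lip : ∃ L : ℝ≥0, LipschitzOnWith L a (Icc 0 1))
    (ha_pos : ∀ x ∈ Icc (0 : ℝ) 1, ν ≤ a x)
    (hd_bdd : MemLp d₀ ⊤ BVControl.volΩ)
    (hd_nonneg : ∀ᵐ x ∂BVControl.volΩ, 0 ≤ d₀ x)
    (hu_d : MemLp u_d ⊤ BVControl.volΩ) :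
    ∃ C : ℝ, 0 < C ∧
      ∀ u q : ℝ → ℝ, BVControl.IsOptimal α a d₀ u_d u q →
        ∀ (T : BVControl.Mesh) (u_h q_h : ℝ → ℝ), BVControl.IsOptimalCd T α a d₀ u_d u_h q_h →
          eLpNorm (fun x => u_h x - u x) 2 BVControl.volΩ ≤ ENNReal.ofReal (C * T.width) := by
  obtain ⟨L, hL⟩ := ha_lip
  have h : BVControl.IsCoeff ν L a d₀ := ⟨hν, hL, ha_pos, hd_bdd, hd_nonneg⟩
  have hd : MemLp u_d 2 BVControl.volΩ := hu_d.mono_exponent le_top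
  obtain ⟨U, -, hU⟩ := BVControl.exists_ae_abs_le hu_d
  have hU' : ∀ᵐ x ∂BVControl.volΩ, |hd.toLp u_d x| ≤ U := by
    filter_upwards [hd.coeFn_toLp, hU] with x e1 e2
    rwa [e1]
  obtain ⟨C, hC, hest⟩ := h.exists_error_estimate hα hU'
  refine ⟨C, hC, fun u q ho T u_h q_h hoh => ?_⟩
  have h1 := hest T _ _ _ _ _ _ (h.isMin_of_isOptimal hd ho) (h.isMin_of_isOptimalCd hd hoh)
  have hu := ho.1.1
  have huh := hoh.1.1.1
  rw [← huh.toLp_eq_primL_grad, ← hu.toLp_eq_primL_grad, ← MemLp.toLp_sub, Lp.norm_toLp] at h1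
  exact (ENNReal.le_ofReal_iff_toReal_le (huh.1.1.sub hu.1.1).eLpNorm_ne_top
    (mul_nonneg hC.le T.width_pos.le)).2 h1
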